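/- **Setup.** Let $(\Theta,\mathscr B)$ and $\mathcal X$ be measurable spaces, $\nu$ a $\sigma$-finite measure on $\mathcal X$, and let $P_\theta$, $\theta\in\Theta$, be probability measures on $\mathcal X$ with $\nu$-densities $p_\theta(x)$, jointly measurable in $(\theta,x)$. Fix $\theta_0\in\Theta$. The data $X^{(n)}=(X_1,\dots,X_n)$ are i.i.d. from $P_{\theta_0}$; write $P_\theta^{(n)}$ for the $n$-fold product of $P_\theta$ and $p_\theta^{(n)}(x)=\prod_{i=1}^n p_\theta(x_i)$. Let $\Pi_n$ be probability measures (priors) on $\Theta$. Let $\widetilde X^{(m)}=(\widetilde X_1,\dots,\widetilde X_m)$, $m=m_n$, be latent variables independent of $X^{(n)}$ with an arbitrary joint law (for instance i.i.d., or fixed), let $T_\theta$ be a generator, jointly measurable in $\theta$ and the latent variable, and let $\hat D^\theta_{n,m}:\mathcal X\to(0,1)$ be any jointly measurable classifier computed from $\theta$, the observed data $X^{(n)}$ and the fake data $T_\theta(\widetilde X_1),\dots,T_\theta(\widetilde X_m)$. With the oracle discriminator $D_\theta=p_{\theta_0}/(p_{\theta_0}+p_\theta)$, the log-posterior residual is $$u_\theta=u_\theta(X^{(n)})=\sum_{i=1}^n\Bigl(\log\frac{1-\hat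 D^\theta_{n,m}(X_i)}{1-D_\theta(X_i)}-\log\frac{\hat D^\theta_{n,m}(X_i)}{D_\theta(X_i)}\Bigr)$$ (an extended real number, equal to $+\infty$ if $p_\theta(X_i)=0<p_{\theta_0}(X_i)$ for some $i$), and the MHC pseudo-posterior is $$\Pi_n^\star(B\mid X^{(n)})=\frac{\int_B \bigl(p_\theta^{(n)}/p_{\theta_0}^{(n)}\bigr)(X^{(n)})\,e^{u_\theta}\,d\Pi_n(\theta)}{\int_\Theta \bigl(p_\theta^{(n)}/p_{\theta_0}^{(n)}\bigr)(X^{(n)})\,e^{u_\theta}\,d\Pi_n(\theta)}.$$ Let $d_n(\theta,\theta')=\bigl(\int(\sqrt{p_\theta}-\sqrt{p_{\theta'}})^2d\nu\bigr)^{1/2}$ be the Hellinger semi-metric, let $N(r,S,d_n)$ be the least number of $d_n$-balls of radius $r$ covering $S\subset\Theta$, and let $$B_n(\theta_0,\epsilon)=\Bigl\{\theta\in\Theta:\ n\int p_{\theta_0}\log\frac{p_{\theta_0}}{p_\theta}\,d\nu\le n\epsilon^2,\ \int p_{\theta_0}\Bigl|\log\frac{p_{\theta_0}}{p_\theta}\Bigr|^2d\nu\le\epsilon^2\Bigr\}.$$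 Below, $P_{\theta_0}^{(n)}$ denotes probability and expectation under the joint law of $X^{(n)}$ and $\widetilde X^{(m)}$. **Theorem.** Let $\varepsilon_n>0$ with $\varepsilon_n\to0$ and $n\varepsilon_n^2\to\infty$, let $\Theta_n\subset\Theta$ be measurable, and let $\widetilde C_n$ be real numbers. Suppose that: 1. for all sufficiently large $n$, $\displaystyle\sup_{\epsilon>\varepsilon_n}\log N\bigl(\tfrac{\epsilon}{36},\{\theta\in\Theta_n:d_n(\theta,\theta_0)<\epsilon\},d_n\bigr)\le n\varepsilon_n^2$; 2. there is $j_0$ such that, for all sufficiently large $n$ and all integers $j\ge j_0$, $\displaystyle\frac{\Pi_n(\theta\in\Theta_n:\ j\varepsilon_n<d_n(\theta,\theta_0)\le 2j\varepsilon_n)}{\Pi_n(B_n(\theta_0,\varepsilon_n))}\le e^{n\varepsilon_n^2j^2/4}$; 3. $\displaystyle P_{\theta_0}^{(n)}\Bigl(\sup_{\theta\in\Theta}|u_\theta(X^{(n)})/n|>\widetilde C_n\varepsilon_n^2\Bigr)\to0$; 4. $\displaystyle\frac{\Pi_n(\Theta\setminus\Theta_n)}{\Pi_n(B_n(\theta_0,\varepsilon_n))}=o\bigl(e^{-2(1+\widetilde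 C_n)n\varepsilon_n^2}\bigr)$. Then, for every sequence $M_n\to\infty$ with $\widetilde C_n=o(M_n)$, $$P_{\theta_0}^{(n)}\Bigl[\Pi_n^\star\bigl(\theta:\ d_n(\theta,\theta_0)>M_n\varepsilon_n\mid X^{(n)}\bigr)\Bigr]\to0\qquad(n\to\infty).$$ -/

import Mathlib

open MeasureTheory Filter Topology Set Asymptotics
open scoped ENNReal NNReal

noncomputable section

namespace MHC

/-- The law `P_θ` on `𝓧` with density `p_θ` with respect to the dominating measure `ν`. -/
def law {Θ 𝓧 : Type*} [MeasurableSpace 𝓧] (ν : Measure 𝓧) (p : Θ → 𝓧 → ℝ≥0) (θ : Θ) :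
    Measure 𝓧 :=
  ν.withDensity fun x => (p θ x : ℝ≥0∞)

/-- The law `P_θ^{(n)}` of `n` i.i.d. observations from `P_θ`. -/
def sampleLaw {Θ 𝓧 : Type*} [MeasurableSpace 𝓧] (ν : Measure 𝓧) (p : Θ → 𝓧 → ℝ≥0)
    (n : ℕ) (θ : Θ) : Measure (Fin n → 𝓧) :=
  Measure.pi fun _ => law ν p θ

/-- The likelihood `p_θ^{(n)}(x) = ∏ i, p_θ(x_i)`. -/
def likelihood {Θ 𝓧 : Type*} (p : Θ → 𝓧 → ℝ≥0) {n : ℕ} (θ : Θ) (x : Fin n → 𝓧) : ℝ≥0∞ :=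
  ∏ i, (p θ (x i) : ℝ≥0∞)

/-- The Hellinger semi-metric `d_n`, with
`d_n(θ,θ')² = (1/n) ∑_{i ≤ n} ∫ (√p_θ - √p_θ')² dν`. -/
def hellinger {Θ 𝓧 : Type*} [MeasurableSpace 𝓧] (ν : Measure 𝓧) (p : Θ → 𝓧 → ℝ≥0)
    (n : ℕ) (θ θ' : Θ) : ℝ :=
  √((1 / (n : ℝ)) * ∑ _i : Fin n, ∫ x, (√(p θ x : ℝ) - √(p θ' x : ℝ)) ^ 2 ∂ν)

/-- `V₂(p_θ, p_θ') = ∫ p_θ |log (p_θ / p_θ')|² dν`; the logarithm is the extended one, so the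
value is `∞` if `p_θ'` vanishes on a set of positive `P_θ`-probability. -/
def V₂ {Θ 𝓧 : Type*} [MeasurableSpace 𝓧] (ν : Measure 𝓧) (p : Θ → 𝓧 → ℝ≥0)
    (θ θ' : Θ) : ℝ≥0∞ :=
  ∫⁻ x, (p θ x : ℝ≥0∞) * (ENNReal.log ((p θ x : ℝ≥0∞) / (p θ' x : ℝ≥0∞))).abs ^ 2 ∂ν

/-- The Kullback–Leibler neighbourhood `B_n(θ₀, ε)`: the parameters `θ` with
`K(p_θ₀^{(n)}, p_θ^{(n)}) = ∑_{i ≤ n} K(p_θ₀, p_θ) ≤ n ε²` and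
`(1/n) ∑_{i ≤ n} V₂(p_θ₀, p_θ) ≤ ε²`. -/
def klBall {Θ 𝓧 : Type*} [MeasurableSpace 𝓧] (ν : Measure 𝓧) (p : Θ → 𝓧 → ℝ≥0)
    (n : ℕ) (θ₀ : Θ) (ε : ℝ) : Set Θ :=
  {θ | ∑ _i : Fin n, InformationTheory.klDiv (law ν p θ₀) (law ν p θ)
        ≤ ENNReal.ofReal ((n : ℝ) * ε ^ 2) ∧
      (1 / (n : ℝ≥0∞)) * ∑ _i : Fin n, V₂ ν p θ₀ θ ≤ ENNReal.ofReal (ε ^ 2)}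

/-- The covering number `N(r, S, d)`: the least number of (closed) `d`-balls of radius `r`, with
centres anywhere in `Θ`, that cover `S`; it is `⊤` if no finite number suffices. -/
def coveringNumber {Θ : Type*} (d : Θ → Θ → ℝ) (r : ℝ) (S : Set Θ) : ℕ∞ :=
  ⨅ (F : Finset Θ) (_ : ∀ θ ∈ S, ∃ c ∈ F, d θ c ≤ r), (F.card : ℕ∞)

/-- The oracle discriminator `D_θ = p_θ₀ / (p_θ₀ + p_θ)`. -/
def oracle {Θ 𝓧 : Type*} (p : Θ → 𝓧 → ℝ≥0) (θ₀ θ : Θ) (y : 𝓧) : ℝ≥0∞ :=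
  (p θ₀ y : ℝ≥0∞) / ((p θ₀ y : ℝ≥0∞) + (p θ y : ℝ≥0∞))

/-- The log-posterior residual
`u_θ(x) = ∑ i, (log ((1 - D(x_i)) / (1 - D_θ(x_i))) - log (D(x_i) / D_θ(x_i)))`
of an estimated discriminator `D : 𝓧 → (0,1)`. It takes values in the extended reals: where
`p_θ(x_i) = 0 < p_θ₀(x_i)`, i.e. `D_θ(x_i) = 1`, it is `+∞`. -/
def residual {Θ 𝓧 : Type*} (p : Θ → 𝓧 → ℝ≥0) (θ₀ θ : Θ) (D : 𝓧 → ℝ) {n : ℕ}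
    (x : Fin n → 𝓧) : EReal :=
  ∑ i, (ENNReal.log ((1 - ENNReal.ofReal (D (x i))) / (1 - oracle p θ₀ θ (x i)))
      - ENNReal.log (ENNReal.ofReal (D (x i)) / oracle p θ₀ θ (x i)))

/-- The pseudo-posterior
`Π*(B | x) = ∫_B (p_θ^{(n)} / p_θ₀^{(n)})(x) e^{u_θ} dΠ(θ) / ∫_Θ (p_θ^{(n)} / p_θ₀^{(n)})(x) e^{u_θ} dΠ(θ)`
for the prior `Π` and the values `u_θ` of the residual at the data. -/
def pseudoPosterior {Θ 𝓧 : Type*} [MeasurableSpace Θ] (p : Θ → 𝓧 → ℝ≥0) (θ₀ : Θ)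
    (prior : Measure Θ) {n : ℕ} (x : Fin n → 𝓧) (u : Θ → EReal) (B : Set Θ) : ℝ≥0∞ :=
  (∫⁻ θ in B, likelihood p θ x / likelihood p θ₀ x * EReal.exp (u θ) ∂prior) /
    ∫⁻ θ, likelihood p θ x / likelihood p θ₀ x * EReal.exp (u θ) ∂prior

end MHC

end

/-! On the event that every `|u_θ|` is at most `L = n C ε²`, the factor `exp (u_θ)` changes the
numerator and the denominator of the pseudo-posterior by at most `e^{±L}`. The pseudo-posterior mass
is then at most `e^{2L}` times the ordinary posterior mass (`pseudoPosterior_le_of_abs_le`), and the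
testing proof of posterior contraction has to absorb this extra factor. Denominator: outside an
event of probability `2 / (n ε²)` the evidence is at least half the prior mass of the
Kullback–Leibler ball times `e^{-2nε²}` (`sampleLaw_evidence_lt_le`). Numerator: the far set is
split into the complement of the sieve, handled by its prior mass, and the shells `jε < d ≤ 2jε`, `j
≥ J = ⌊M⌋`. Each shell has a test with errors `e^{nε² - nj²ε²/6}` and `e^{-nj²ε²/3}`
(`exists_shell_test`). Against the prior ratio `e^{nj²ε²/4}` a gain of `nj²ε²/12` remains, quadratic
in `j`, whereas the total cost `2(1+C)nε²` is at most linear in `j` because `C ≤ 2J`. All sums are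
thus tails of `∑ e^{-j}`. The tests rest on one statistic that separates `θ₀` from a whole Hellinger
ball around `c`: the product of `√(p_c/p_θ₀)` mixed with a constant, whose inverse stays bounded. -/

noncomputable section

namespace MHC

/-! ### One-observation bounds for the robust test -/

section RobustTest

variable {𝓧 : Type*}

/-- The weight `1/12 + 11/12 √(q / p)` whose product is the statistic of the robust
likelihood ratio test of `p` against a Hellinger neighbourhood of `q`. -/
def testWeight (p q : 𝓧 → ℝ≥0) (x : 𝓧) : ℝ≥0 :=
  1 / 12 + 11 / 12 * NNReal.sqrt (q x / p x)

lemma testWeight_pos (p q : 𝓧 → ℝ≥0) (x : 𝓧) : 0 < testWeight p q x := by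
  unfold testWeight
  positivity

lemma coe_testWeight (p q : 𝓧 → ℝ≥0) (x : 𝓧) :
    (testWeight p q x : ℝ) = 1 / 12 + 11 / 12 * (√(q x : ℝ) / √(p x : ℝ)) := by
  simp [testWeight, NNReal.coe_add]

variable [MeasurableSpace 𝓧]

/-- The squared Hellinger distance between two densities. -/
def sqHellinger (ν : Measure 𝓧) (p q : 𝓧 → ℝ≥0) : ℝ :=
  ∫ x, (√(p x : ℝ) - √(q x : ℝ)) ^ 2 ∂ν

lemma sqHellinger_nonneg (ν : Measure 𝓧) (p q : 𝓧 → ℝ≥0) : 0 ≤ sqHellinger ν p q :=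
  integral_nonneg fun _ => sq_nonneg _

variable {ν : Measure 𝓧} {p q s : 𝓧 → ℝ≥0}

lemma integrable_of_lintegral_eq_one (hp : Measurable p) (hp1 : ∫⁻ x, (p x : ℝ≥0∞) ∂ν = 1) :
    Integrable (fun x => (p x : ℝ)) ν := by
  refine ⟨hp.coe_nnreal_real.aestronglyMeasurable, ?_⟩
  simp [HasFiniteIntegral, enorm, hp1]

lemma integral_of_lintegral_eq_one (hp : Measurable p) (hp1 : ∫⁻ x, (p x : ℝ≥0∞) ∂ν = 1) :
    ∫ x, (p x : ℝ) ∂ν = 1 := by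
  rw [integral_eq_lintegral_of_nonneg_ae (ae_of_all _ fun x => NNReal.coe_nonneg (p x))
    hp.coe_nnreal_real.aestronglyMeasurable]
  simp [hp1]

lemma integrable_sqrt_sub_sq (hp : Measurable p) (hp1 : ∫⁻ x, (p x : ℝ≥0∞) ∂ν = 1)
    (hq : Measurable q) (hq1 : ∫⁻ x, (q x : ℝ≥0∞) ∂ν = 1) :
    Integrable (fun x => (√(p x : ℝ) - √(q x : ℝ)) ^ 2) ν := by
  refine Integrable.mono' (((integrable_of_lintegral_eq_one hp hp1).add
    (integrable_of_lintegral_eq_one hq hq1)).const_mul 2) ?_ (ae_of_all _ fun x => ?_)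
  · exact ((hp.coe_nnreal_real.sqrt.sub hq.coe_nnreal_real.sqrt).pow_const 2).aestronglyMeasurable
  · have h1 := Real.sq_sqrt (p x).2
    have h2 := Real.sq_sqrt (q x).2
    simp only [Real.norm_eq_abs, abs_sq, Pi.add_apply, NNReal.val_eq_coe] at *
    nlinarith [sq_nonneg (√(p x : ℝ) + √(q x : ℝ))]

/-- Weighted triangle inequality for the squared Hellinger distance. -/
lemma sqHellinger_triangle (hp : Measurable p) (hp1 : ∫⁻ x, (p x : ℝ≥0∞) ∂ν = 1)
    (hq : Measurable q) (hq1 : ∫⁻ x, (q x : ℝ≥0∞) ∂ν = 1)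
    (hs : Measurable s) (hs1 : ∫⁻ x, (s x : ℝ≥0∞) ∂ν = 1) :
    sqHellinger ν p s ≤ 17 / 16 * sqHellinger ν q s + 17 * sqHellinger ν p q := by
  have i1 := integrable_sqrt_sub_sq hp hp1 hq hq1
  have i2 := integrable_sqrt_sub_sq hq hq1 hs hs1
  have i3 := integrable_sqrt_sub_sq hp hp1 hs hs1
  unfold sqHellinger
  rw [← integral_const_mul, ← integral_const_mul, ← integral_add (i2.const_mul _) (i1.const_mul _)]
  refine integral_mono i3 ((i2.const_mul _).add (i1.const_mul _)) fun x => ?_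
  -- This is `(a + b)² ≤ (1 + 1/16) a² + (1 + 16) b²`, whose defect is `(a - 16 b)² / 16`.
  nlinarith [sq_nonneg ((√(q x : ℝ) - √(s x : ℝ)) - 16 * (√(p x : ℝ) - √(q x : ℝ)))]

lemma measurable_testWeight (hp : Measurable p) (hq : Measurable q) :
    Measurable (testWeight p q) := by
  unfold testWeight
  fun_prop

/-- Pointwise `p √(q/p) = √(pq) = (p + q - (√q - √p)²) / 2`, also where `p = 0`, so the mean weight
is governed by the Hellinger affinity. -/
lemma lintegral_mul_testWeight_le (hp : Measurable p) (hp1 : ∫⁻ x, (p x : ℝ≥0∞) ∂ν = 1)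
    (hq : Measurable q) (hq1 : ∫⁻ x, (q x : ℝ≥0∞) ∂ν = 1) :
    ∫⁻ x, (p x : ℝ≥0∞) * (testWeight p q x : ℝ≥0∞) ∂ν
      ≤ ENNReal.ofReal (1 - 11 / 24 * sqHellinger ν q p) := by
  have i0 := integrable_of_lintegral_eq_one hp hp1
  have i1 := integrable_of_lintegral_eq_one hq hq1
  have i2 := integrable_sqrt_sub_sq hq hq1 hp hp1
  have key : ∀ x, (p x : ℝ≥0∞) * (testWeight p q x : ℝ≥0∞)
      ≤ ENNReal.ofReal (13 / 24 * (p x : ℝ) + 11 / 24 * (q x : ℝ)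
        - 11 / 24 * (√(q x : ℝ) - √(p x : ℝ)) ^ 2) := by
    intro x
    rw [← ENNReal.coe_mul, ← ENNReal.ofReal_coe_nnreal]
    apply ENNReal.ofReal_le_ofReal
    rw [NNReal.coe_mul, coe_testWeight]
    have hf := Real.sq_sqrt (p x).2
    have hg := Real.sq_sqrt (q x).2
    have hf0 := Real.sqrt_nonneg (p x : ℝ)
    have hg0 := Real.sqrt_nonneg (q x : ℝ)
    simp only [NNReal.val_eq_coe] at hf hg
    have h : (p x : ℝ) * (√(q x : ℝ) / √(p x : ℝ)) = √(p x : ℝ) * √(q x : ℝ) := by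
      rcases hf0.eq_or_lt with h0 | h0
      · rw [← h0]; simp
      · rw [← hf, Real.sqrt_sq hf0]; field_simp
    nlinarith
  refine (lintegral_mono key).trans ?_
  have hi := ((i0.const_mul (13 / 24)).add (i1.const_mul (11 / 24))).sub (i2.const_mul (11 / 24))
  have hval : ∫ x, (13 / 24 * (p x : ℝ) + 11 / 24 * (q x : ℝ)
        - 11 / 24 * (√(q x : ℝ) - √(p x : ℝ)) ^ 2) ∂ν = 1 - 11 / 24 * sqHellinger ν q p := by
    rw [integral_sub (by exact (i0.const_mul (13 / 24)).add (i1.const_mul (11 / 24)))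
      (i2.const_mul (11 / 24)), integral_add (i0.const_mul (13 / 24)) (i1.const_mul (11 / 24)),
      integral_const_mul, integral_const_mul, integral_const_mul,
      integral_of_lintegral_eq_one hp hp1, integral_of_lintegral_eq_one hq hq1, sqHellinger]
    norm_num
  rw [← hval]
  refine (ofReal_integral_eq_lintegral_ofReal hi ?_).ge
  · refine ae_of_all _ fun x => ?_
    have hf := Real.sq_sqrt (p x).2
    have hg := Real.sq_sqrt (q x).2
    simp only [NNReal.val_eq_coe] at hf hg
    simp only [Pi.zero_apply, Pi.sub_apply, Pi.add_apply]
    nlinarith [mul_nonneg (Real.sqrt_nonneg (p x : ℝ)) (Real.sqrt_nonneg (q x : ℝ)), (p x).2]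

/-- With `f, g, h` the roots of `p, q, s` and `r` equal to `f` times the weight, the integrand is
`h² f / r`. The constant `1/12` in the weight gives `f ≤ 12 r`, so replacing `q` by a nearby `s`
costs only a multiple of their squared Hellinger distance. -/
lemma lintegral_div_mul_inv_testWeight_le (hp : Measurable p)
    (hp1 : ∫⁻ x, (p x : ℝ≥0∞) ∂ν = 1) (hq : Measurable q) (hq1 : ∫⁻ x, (q x : ℝ≥0∞) ∂ν = 1)
    (hs : Measurable s) (hs1 : ∫⁻ x, (s x : ℝ≥0∞) ∂ν = 1)
    (hD : 256 * sqHellinger ν s q ≤ sqHellinger ν q p) :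
    ∫⁻ x, (p x : ℝ≥0∞) * ((s x : ℝ≥0∞) / (p x : ℝ≥0∞) * ((testWeight p q x)⁻¹ : ℝ≥0)) ∂ν
      ≤ ENNReal.ofReal (1 - 4 / 25 * sqHellinger ν q p) := by
  have i0 := integrable_of_lintegral_eq_one hp hp1
  have i1 := integrable_of_lintegral_eq_one hq hq1
  have i2 := integrable_of_lintegral_eq_one hs hs1
  have j1 := integrable_sqrt_sub_sq hq hq1 hp hp1
  have j2 := integrable_sqrt_sub_sq hs hs1 hq hq1
  -- The `11/24` terms integrate to zero; for `s = q` they match the part of the integrand of first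
  -- order in `√q - √p`.
  set F : 𝓧 → ℝ := fun x => (s x : ℝ) + 11 / 24 * (p x : ℝ) - 11 / 24 * (q x : ℝ)
    - 1 / 3 * (√(q x : ℝ) - √(p x : ℝ)) ^ 2 + 43 * (√(s x : ℝ) - √(q x : ℝ)) ^ 2 with hF
  have key : ∀ x, 0 ≤ F x ∧ (p x ≠ 0 → (s x : ℝ) * (testWeight p q x : ℝ)⁻¹ ≤ F x) := by
    intro x
    have hf := Real.sq_sqrt (p x).2
    have hg := Real.sq_sqrt (q x).2
    have hh := Real.sq_sqrt (s x).2
    have hf0 := Real.sqrt_nonneg (p x : ℝ)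
    have hg0 := Real.sqrt_nonneg (q x : ℝ)
    simp only [NNReal.val_eq_coe] at hf hg hh
    have hw := coe_testWeight p q x
    simp only [hF, hw]
    rw [← hf, ← hg, ← hh, Real.sqrt_sq hf0, Real.sqrt_sq hg0, Real.sqrt_sq (Real.sqrt_nonneg _)]
    have hfp : p x ≠ 0 → 0 < √(p x : ℝ) := fun h =>
      Real.sqrt_pos.2 (NNReal.coe_pos.2 (pos_iff_ne_zero.2 h))
    generalize √(p x : ℝ) = f at *
    generalize √(q x : ℝ) = g at *
    generalize √(s x : ℝ) = h at *
    obtain ⟨r, hr⟩ : ∃ r, r = 1 / 12 * f + 11 / 12 * g := ⟨_, rfl⟩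
    have hfr : f ≤ 12 * r := by linarith
    have hr0 : 0 ≤ r := by linarith
    -- For `r > 0` the left side dominates `h² f / r = f r + 2 f (h - r) + (f / r) (h - r)²`, since
    -- `f ≤ 12 r`.
    have hlow : f * r + 2 * f * (h - r) + 12 * (h - r) ^ 2 ≤
        h ^ 2 + 11 / 24 * f ^ 2 - 11 / 24 * g ^ 2 - 1 / 3 * (g - f) ^ 2 + 43 * (h - g) ^ 2 := by
      subst hr
      nlinarith [sq_nonneg ((g - f) - 16 * (g - h)), sq_nonneg ((g - f) - 16 * (h - g))]
    refine ⟨le_trans ?_ hlow, fun hp0 => le_trans ?_ hlow⟩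
    · rcases hr0.eq_or_lt with h0 | h0
      · have : f = 0 := by linarith
        rw [this]; nlinarith [sq_nonneg (h - r)]
      · have : 0 ≤ r * (f * r + 2 * f * (h - r) + 12 * (h - r) ^ 2) := by
          nlinarith [mul_nonneg hf0 (sq_nonneg h), mul_nonneg (sub_nonneg.2 hfr)
            (sq_nonneg (h - r))]
        exact nonneg_of_mul_nonneg_right this h0
    · have hfpos := hfp hp0
      have hrpos : 0 < r := by linarith
      have : (1 / 12 + 11 / 12 * (g / f))⁻¹ = f / r := by
        rw [hr]; field_simp
      rw [this, mul_div_assoc', div_le_iff₀ hrpos]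
      nlinarith [mul_nonneg (sub_nonneg.2 hfr) (sq_nonneg (h - r))]
  have hi : Integrable F ν :=
    (((i2.add (i0.const_mul (11 / 24))).sub (i1.const_mul (11 / 24))).sub
      (j1.const_mul (1 / 3))).add (j2.const_mul 43)
  have hval : ∫ x, F x ∂ν = 1 - 1 / 3 * sqHellinger ν q p + 43 * sqHellinger ν s q := by
    have k1 : Integrable (fun x => (s x : ℝ) + 11 / 24 * (p x : ℝ)) ν := i2.add (i0.const_mul _)
    have k2 : Integrable (fun x => (s x : ℝ) + 11 / 24 * (p x : ℝ) - 11 / 24 * (q x : ℝ)) ν :=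
      k1.sub (i1.const_mul _)
    have k3 : Integrable (fun x => (s x : ℝ) + 11 / 24 * (p x : ℝ) - 11 / 24 * (q x : ℝ)
        - 1 / 3 * (√(q x : ℝ) - √(p x : ℝ)) ^ 2) ν := k2.sub (j1.const_mul _)
    rw [hF, integral_add k3 (j2.const_mul 43), integral_sub k2 (j1.const_mul (1 / 3)),
      integral_sub k1 (i1.const_mul (11 / 24)),
      integral_add i2 (i0.const_mul (11 / 24)),
      integral_const_mul, integral_const_mul, integral_const_mul, integral_const_mul,
      integral_of_lintegral_eq_one hp hp1, integral_of_lintegral_eq_one hq hq1,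
      integral_of_lintegral_eq_one hs hs1, sqHellinger, sqHellinger]
    ring
  calc _ ≤ ∫⁻ x, ENNReal.ofReal (F x) ∂ν := by
        refine lintegral_mono fun x => ?_
        by_cases h0 : p x = 0
        · simp [h0]
        · rw [← mul_assoc, ENNReal.mul_div_cancel (by simpa using h0) ENNReal.coe_ne_top,
            ← ENNReal.coe_mul, ← ENNReal.ofReal_coe_nnreal]
          apply ENNReal.ofReal_le_ofReal
          rw [NNReal.coe_mul, NNReal.coe_inv]
          exact (key x).2 h0
    _ = ENNReal.ofReal (∫ x, F x ∂ν) :=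
        (ofReal_integral_eq_lintegral_ofReal hi (ae_of_all _ fun x => (key x).1)).symm
    _ ≤ _ := by
        apply ENNReal.ofReal_le_ofReal
        rw [hval]
        -- `43/256 + 4/25 < 1/3`.
        linarith [sqHellinger_nonneg ν q p]

end RobustTest

/-! ### Product laws -/

section Sample
variable {Θ 𝓧 : Type*} [MeasurableSpace 𝓧] {ν : Measure 𝓧} {p : Θ → 𝓧 → ℝ≥0}

lemma isProbabilityMeasure_law (hp_one : ∀ θ, ∫⁻ x, (p θ x : ℝ≥0∞) ∂ν = 1) (θ : Θ) :
    IsProbabilityMeasure (law ν p θ) := by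
  constructor
  simp [law, hp_one]

lemma isProbabilityMeasure_sampleLaw (hp_one : ∀ θ, ∫⁻ x, (p θ x : ℝ≥0∞) ∂ν = 1) (n : ℕ) (θ : Θ) :
    IsProbabilityMeasure (sampleLaw ν p n θ) := by
  have := isProbabilityMeasure_law hp_one θ
  unfold sampleLaw
  infer_instance

lemma lintegral_law (hp : ∀ θ, Measurable (p θ)) (θ : Θ) (f : 𝓧 → ℝ≥0∞) :
    ∫⁻ x, f x ∂law ν p θ = ∫⁻ x, (p θ x : ℝ≥0∞) * f x ∂ν := by
  unfold law
  rw [lintegral_withDensity_eq_lintegral_mul_non_measurable _ (hp θ).coe_nnreal_ennreal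
    (ae_of_all _ fun x => ENNReal.coe_lt_top)]
  rfl

lemma lintegral_sampleLaw_prod (hp_one : ∀ θ, ∫⁻ x, (p θ x : ℝ≥0∞) ∂ν = 1)
    (n : ℕ) (θ : Θ) {f : 𝓧 → ℝ≥0∞} (hf : Measurable f) :
    ∫⁻ x, ∏ i, f (x i) ∂sampleLaw ν p n θ = (∫⁻ y, f y ∂law ν p θ) ^ n := by
  have := isProbabilityMeasure_law hp_one θ
  unfold sampleLaw
  rw [ProbabilityTheory.lintegral_prod_eq_prod_lintegral_of_indepFun Finset.univ
    (fun i (x : Fin n → 𝓧) => f (x i))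
    (ProbabilityTheory.iIndepFun_pi fun _ => hf.aemeasurable)
    (fun i => hf.comp (measurable_pi_apply i))]
  have h (i : Fin n) : ∫⁻ x : Fin n → 𝓧, f (x i) ∂Measure.pi (fun _ => law ν p θ)
      = ∫⁻ y, f y ∂law ν p θ :=
    (measurePreserving_eval (fun _ : Fin n => law ν p θ) i).lintegral_comp hf
  simp [h]

/-- Powers of `1 - a` are bounded by exponentials. -/
lemma ofReal_one_sub_pow_le (a : ℝ) (n : ℕ) :
    ENNReal.ofReal (1 - a) ^ n ≤ ENNReal.ofReal (Real.exp (-(n * a))) := by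
  have h : ENNReal.ofReal (1 - a) ≤ ENNReal.ofReal (Real.exp (-a)) :=
    ENNReal.ofReal_le_ofReal (by linarith [Real.add_one_le_exp (-a)])
  refine (pow_le_pow_left₀ zero_le h n).trans_eq ?_
  rw [← ENNReal.ofReal_pow (Real.exp_nonneg _), ← Real.exp_nat_mul, mul_neg]

lemma ae_law_ne_zero (hp : ∀ θ, Measurable (p θ)) (θ : Θ) : ∀ᵐ y ∂law ν p θ, p θ y ≠ 0 := by
  unfold law
  rw [ae_withDensity_iff (hp θ).coe_nnreal_ennreal]
  exact ae_of_all _ fun x hx => by simpa using hx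

lemma ae_sampleLaw_of_ae_law (hp_one : ∀ θ, ∫⁻ x, (p θ x : ℝ≥0∞) ∂ν = 1) (n : ℕ) (θ : Θ)
    {P : 𝓧 → Prop} (h : ∀ᵐ y ∂law ν p θ, P y) : ∀ᵐ x ∂sampleLaw ν p n θ, ∀ i, P (x i) := by
  have := isProbabilityMeasure_law hp_one θ
  rw [ae_all_iff]
  exact fun i => (Measure.quasiMeasurePreserving_eval (fun _ : Fin n => law ν p θ) i).ae h

end Sample

/-! ### Error bounds for `n` observations -/

/-- The rejection region of the robust test of `θ₀` against a neighbourhood of `c`. -/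
def testRegion {Θ 𝓧 : Type*} [MeasurableSpace 𝓧] (ν : Measure 𝓧) (p : Θ → 𝓧 → ℝ≥0) (n : ℕ)
    (θ₀ c : Θ) : Set (Fin n → 𝓧) :=
  {x | Real.exp (-(n * (6 / 25 * sqHellinger ν (p c) (p θ₀))))
    < ((∏ i, testWeight (p θ₀) (p c) (x i) : ℝ≥0) : ℝ)}

section Test
variable {Θ 𝓧 : Type*} [MeasurableSpace 𝓧] {ν : Measure 𝓧} {p : Θ → 𝓧 → ℝ≥0}

lemma measurableSet_testRegion (hp : ∀ θ, Measurable (p θ)) (n : ℕ) (θ₀ c : Θ) :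
    MeasurableSet (testRegion ν p n θ₀ c) := by
  have := measurable_testWeight (hp θ₀) (hp c)
  refine measurableSet_lt measurable_const (Measurable.coe_nnreal_real ?_)
  exact Finset.measurable_prod _ fun i _ => this.comp (measurable_pi_apply i)

/-- Markov's inequality for the product of weights; `11/24 - 6/25 > 1/5`. -/
lemma sampleLaw_testRegion_le (hp : ∀ θ, Measurable (p θ))
    (hp_one : ∀ θ, ∫⁻ x, (p θ x : ℝ≥0∞) ∂ν = 1) (n : ℕ) (θ₀ c : Θ) :
    sampleLaw ν p n θ₀ (testRegion ν p n θ₀ c)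
      ≤ ENNReal.ofReal (Real.exp (-(n * (1 / 5 * sqHellinger ν (p c) (p θ₀))))) := by
  set D := sqHellinger ν (p c) (p θ₀) with hD
  have hD0 : 0 ≤ D := sqHellinger_nonneg _ _ _
  have hw := measurable_testWeight (hp θ₀) (hp c)
  set K := ENNReal.ofReal (Real.exp (n * (6 / 25 * D))) with hK
  have hpt : ∀ x : Fin n → 𝓧, (testRegion ν p n θ₀ c).indicator 1 x
      ≤ K * ∏ i, (testWeight (p θ₀) (p c) (x i) : ℝ≥0∞) := by
    intro x
    refine indicator_le' (f := 1) (g := fun x : Fin n → 𝓧 =>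
      K * ∏ i, (testWeight (p θ₀) (p c) (x i) : ℝ≥0∞)) (fun x hx => ?_) (fun _ _ => zero_le) x
    rw [← ENNReal.ofNNReal_finsetProd, ← ENNReal.ofReal_coe_nnreal, hK,
      ← ENNReal.ofReal_mul (Real.exp_nonneg _), Pi.one_apply]
    rw [← ENNReal.ofReal_one]
    apply ENNReal.ofReal_le_ofReal
    have hx' : Real.exp (-(n * (6 / 25 * D))) ≤ _ := le_of_lt (mem_ofPred_eq ▸ hx)
    calc (1 : ℝ) = Real.exp (n * (6 / 25 * D)) * Real.exp (-(n * (6 / 25 * D))) := by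
          rw [← Real.exp_add]; simp
      _ ≤ _ := by gcongr
  calc sampleLaw ν p n θ₀ (testRegion ν p n θ₀ c)
      = ∫⁻ x, (testRegion ν p n θ₀ c).indicator 1 x ∂sampleLaw ν p n θ₀ :=
        (lintegral_indicator_one (measurableSet_testRegion hp n θ₀ c)).symm
    _ ≤ ∫⁻ x, K * ∏ i, (testWeight (p θ₀) (p c) (x i) : ℝ≥0∞) ∂sampleLaw ν p n θ₀ :=
        lintegral_mono hpt
    _ = K * (∫⁻ y, (p θ₀ y : ℝ≥0∞) * (testWeight (p θ₀) (p c) y : ℝ≥0∞) ∂ν) ^ n := by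
        rw [lintegral_const_mul' _ _ ENNReal.ofReal_ne_top,
          lintegral_sampleLaw_prod hp_one n θ₀ hw.coe_nnreal_ennreal, lintegral_law hp]
    _ ≤ K * ENNReal.ofReal (1 - 11 / 24 * D) ^ n := by
        gcongr
        exact lintegral_mul_testWeight_le (hp θ₀) (hp_one θ₀) (hp c) (hp_one c)
    _ ≤ K * ENNReal.ofReal (Real.exp (-(n * (11 / 24 * D)))) := by
        gcongr
        exact ofReal_one_sub_pow_le _ _
    _ ≤ _ := by
        rw [hK, ← ENNReal.ofReal_mul (Real.exp_nonneg _), ← Real.exp_add]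
        apply ENNReal.ofReal_le_ofReal
        apply Real.exp_le_exp.2
        nlinarith [mul_nonneg (Nat.cast_nonneg n : (0 : ℝ) ≤ n) hD0]

/-- Off the rejection region the inverse product is at least `e^{6nD/25}`; its mean supplies the
remaining `4/25` of the exponent. -/
lemma lintegral_likelihood_ratio_compl_testRegion_le (hp : ∀ θ, Measurable (p θ))
    (hp_one : ∀ θ, ∫⁻ x, (p θ x : ℝ≥0∞) ∂ν = 1) (n : ℕ) (θ₀ c θ : Θ)
    (hc : 256 * sqHellinger ν (p θ) (p c) ≤ sqHellinger ν (p c) (p θ₀)) :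
    ∫⁻ x in (testRegion ν p n θ₀ c)ᶜ, likelihood p θ x / likelihood p θ₀ x ∂sampleLaw ν p n θ₀
      ≤ ENNReal.ofReal (Real.exp (-(n * (2 / 5 * sqHellinger ν (p c) (p θ₀))))) := by
  set D := sqHellinger ν (p c) (p θ₀) with hD
  have hD0 : 0 ≤ D := sqHellinger_nonneg _ _ _
  have hw := measurable_testWeight (hp θ₀) (hp c)
  set K := ENNReal.ofReal (Real.exp (-(n * (6 / 25 * D)))) with hK
  set f : 𝓧 → ℝ≥0∞ := fun y =>
    (p θ y : ℝ≥0∞) / (p θ₀ y : ℝ≥0∞) * ((testWeight (p θ₀) (p c) y)⁻¹ : ℝ≥0) with hf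
  have hfm : Measurable f :=
    ((hp θ).coe_nnreal_ennreal.div (hp θ₀).coe_nnreal_ennreal).mul hw.inv.coe_nnreal_ennreal
  have hpt : ∀ x, (testRegion ν p n θ₀ c)ᶜ.indicator
      (fun x => likelihood p θ x / likelihood p θ₀ x) x ≤ K * ∏ i, f (x i) := by
    intro x
    by_cases hmem : x ∈ (testRegion ν p n θ₀ c)ᶜ
    swap
    · simp [hmem]
    rw [indicator_of_mem hmem]
    have h1 : ∏ i, f (x i) = likelihood p θ x / likelihood p θ₀ x
        * ((∏ i, testWeight (p θ₀) (p c) (x i))⁻¹ : ℝ≥0) := by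
      simp only [hf, likelihood, Finset.prod_mul_distrib]
      rw [← Finset.prod_inv_distrib, ENNReal.ofNNReal_finsetProd,
        ENNReal.prod_div_distrib]
      exact fun i _ j _ _ => by simp
    have h2 : 1 ≤ K * ((∏ i, testWeight (p θ₀) (p c) (x i))⁻¹ : ℝ≥0) := by
      have hpos : 0 < ∏ i, testWeight (p θ₀) (p c) (x i) :=
        Finset.prod_pos fun i _ => testWeight_pos _ _ _
      have hle : ((∏ i, testWeight (p θ₀) (p c) (x i) : ℝ≥0) : ℝ)
          ≤ Real.exp (-(n * (6 / 25 * D))) := not_lt.1 hmem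
      rw [hK, ← ENNReal.ofReal_coe_nnreal, ← ENNReal.ofReal_mul (Real.exp_nonneg _),
        ← ENNReal.ofReal_one]
      apply ENNReal.ofReal_le_ofReal
      rw [NNReal.coe_inv, ← div_eq_mul_inv, one_le_div (by exact_mod_cast hpos)]
      exact hle
    calc likelihood p θ x / likelihood p θ₀ x
        = 1 * (likelihood p θ x / likelihood p θ₀ x) := (one_mul _).symm
      _ ≤ (K * ((∏ i, testWeight (p θ₀) (p c) (x i))⁻¹ : ℝ≥0))
          * (likelihood p θ x / likelihood p θ₀ x) := by gcongr
      _ = _ := by rw [h1]; ring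
  rw [← lintegral_indicator (measurableSet_testRegion hp n θ₀ c).compl]
  calc _ ≤ ∫⁻ x, K * ∏ i, f (x i) ∂sampleLaw ν p n θ₀ := lintegral_mono hpt
    _ = K * (∫⁻ y, (p θ₀ y : ℝ≥0∞) * f y ∂ν) ^ n := by
        rw [lintegral_const_mul' _ _ ENNReal.ofReal_ne_top,
          lintegral_sampleLaw_prod hp_one n θ₀ hfm, lintegral_law hp]
    _ ≤ K * ENNReal.ofReal (1 - 4 / 25 * D) ^ n := by
        gcongr
        exact lintegral_div_mul_inv_testWeight_le (hp θ₀) (hp_one θ₀) (hp c) (hp_one c)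
          (hp θ) (hp_one θ) hc
    _ ≤ K * ENNReal.ofReal (Real.exp (-(n * (4 / 25 * D)))) := by
        gcongr
        exact ofReal_one_sub_pow_le _ _
    _ = _ := by
        rw [hK, ← ENNReal.ofReal_mul (Real.exp_nonneg _), ← Real.exp_add]
        congr 2
        ring

/-- The mass of `P_θ` where `p_θ₀` vanishes is lost, hence only an inequality. -/
lemma lintegral_likelihood_ratio_le_one (hp : ∀ θ, Measurable (p θ))
    (hp_one : ∀ θ, ∫⁻ x, (p θ x : ℝ≥0∞) ∂ν = 1) (n : ℕ) (θ₀ θ : Θ) :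
    ∫⁻ x, likelihood p θ x / likelihood p θ₀ x ∂sampleLaw ν p n θ₀ ≤ 1 := by
  have h (x : Fin n → 𝓧) : likelihood p θ x / likelihood p θ₀ x
      = ∏ i, (p θ (x i) : ℝ≥0∞) / (p θ₀ (x i) : ℝ≥0∞) := by
    rw [ENNReal.prod_div_distrib]
    · rfl
    · exact fun i _ j _ _ => by simp
  simp only [h]
  rw [lintegral_sampleLaw_prod hp_one n θ₀
    (f := fun y => (p θ y : ℝ≥0∞) / (p θ₀ y : ℝ≥0∞))
    ((hp θ).coe_nnreal_ennreal.div (hp θ₀).coe_nnreal_ennreal), lintegral_law hp]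
  refine pow_le_one₀ zero_le ((lintegral_mono fun y => ?_).trans_eq (hp_one θ))
  exact ENNReal.mul_div_le

end Test

/-! ### From balls to covered sets -/

section ShellTest
variable {Θ 𝓧 : Type*} [MeasurableSpace 𝓧] {ν : Measure 𝓧} {p : Θ → 𝓧 → ℝ≥0}

lemma hellinger_eq_sqrt (ν : Measure 𝓧) (p : Θ → 𝓧 → ℝ≥0) {n : ℕ} (hn : n ≠ 0) (θ θ' : Θ) :
    hellinger ν p n θ θ' = √(sqHellinger ν (p θ) (p θ')) := by
  have : (n : ℝ) ≠ 0 := by exact_mod_cast hn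
  simp only [hellinger, sqHellinger, Finset.sum_const, Finset.card_univ, Fintype.card_fin,
    nsmul_eq_mul]
  congr 1
  field_simp

/-- A test of `θ₀` against a set at Hellinger distance more than `s` that is covered by finitely
many balls of radius `s / 17`. -/
lemma exists_test_of_cover (hp : ∀ θ, Measurable (p θ))
    (hp_one : ∀ θ, ∫⁻ x, (p θ x : ℝ≥0∞) ∂ν = 1) (n : ℕ) (θ₀ : Θ) {s : ℝ} {A : Set Θ}
    (hA : ∀ θ ∈ A, s ^ 2 ≤ sqHellinger ν (p θ) (p θ₀)) (F : Finset Θ)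
    (hF : ∀ θ ∈ A, ∃ c ∈ F, 289 * sqHellinger ν (p θ) (p c) ≤ s ^ 2) :
    ∃ Φ : Set (Fin n → 𝓧), MeasurableSet Φ ∧
      sampleLaw ν p n θ₀ Φ ≤ F.card * ENNReal.ofReal (Real.exp (-(n * s ^ 2 / 6))) ∧
      ∀ θ ∈ A, ∫⁻ x in Φᶜ, likelihood p θ x / likelihood p θ₀ x ∂sampleLaw ν p n θ₀
        ≤ ENNReal.ofReal (Real.exp (-(n * s ^ 2 / 3))) := by
  classical
  have hn : (0 : ℝ) ≤ n := Nat.cast_nonneg n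
  -- The triangle inequality gives `(1 - 1/17) s² ≤ (17/16) h²(c, θ₀)`. Hence `256 h²(θ, c) ≤ h²(c,
  -- θ₀)`, the robustness ratio, and the error exponents hold because `256/289` times `1/5` and
  -- `2/5` exceeds `1/6` and `1/3`.
  have hsep : ∀ θ ∈ A, ∀ c, 289 * sqHellinger ν (p θ) (p c) ≤ s ^ 2 →
      256 * s ^ 2 ≤ 289 * sqHellinger ν (p c) (p θ₀) := by
    intro θ hθ c hc
    have h1 := sqHellinger_triangle (hp θ) (hp_one θ) (hp c) (hp_one c) (hp θ₀) (hp_one θ₀)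
    linarith [hA θ hθ]
  -- A centre far from `A` may lie close to `θ₀`, where its test has no useful level; such centres
  -- are dropped.
  set G := F.filter fun c => ∃ θ ∈ A, 289 * sqHellinger ν (p θ) (p c) ≤ s ^ 2 with hG
  refine ⟨⋃ c ∈ G, testRegion ν p n θ₀ c,
    Finset.measurableSet_biUnion _ fun c _ => measurableSet_testRegion hp n θ₀ c, ?_, ?_⟩
  · calc _ ≤ ∑ c ∈ G, sampleLaw ν p n θ₀ (testRegion ν p n θ₀ c) :=
          measure_biUnion_finset_le _ _
      _ ≤ ∑ c ∈ G, ENNReal.ofReal (Real.exp (-(n * s ^ 2 / 6))) := by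
          refine Finset.sum_le_sum fun c hc => ?_
          obtain ⟨θ, hθ, hθc⟩ := (Finset.mem_filter.1 hc).2
          refine (sampleLaw_testRegion_le hp hp_one n θ₀ c).trans ?_
          apply ENNReal.ofReal_le_ofReal
          apply Real.exp_le_exp.2
          have h1 := hsep θ hθ c hθc
          have h2 : s ^ 2 / 6 ≤ 1 / 5 * sqHellinger ν (p c) (p θ₀) := by
            nlinarith [sq_nonneg s]
          nlinarith [mul_le_mul_of_nonneg_left h2 hn]
      _ ≤ _ := by
          rw [Finset.sum_const, nsmul_eq_mul]
          gcongr
          exact Finset.filter_subset _ _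
  · intro θ hθ
    obtain ⟨c, hcF, hc⟩ := hF θ hθ
    have hcG : c ∈ G := Finset.mem_filter.2 ⟨hcF, θ, hθ, hc⟩
    have h1 := hsep θ hθ c hc
    calc _ ≤ ∫⁻ x in (testRegion ν p n θ₀ c)ᶜ, likelihood p θ x / likelihood p θ₀ x
          ∂sampleLaw ν p n θ₀ :=
          lintegral_mono_set (compl_subset_compl.2 (subset_biUnion_of_mem
            (u := fun c => testRegion ν p n θ₀ c) (by exact_mod_cast hcG)))
      _ ≤ _ := lintegral_likelihood_ratio_compl_testRegion_le hp hp_one n θ₀ c θ (by linarith)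
      _ ≤ _ := by
          apply ENNReal.ofReal_le_ofReal
          apply Real.exp_le_exp.2
          have h2 : s ^ 2 / 3 ≤ 2 / 5 * sqHellinger ν (p c) (p θ₀) := by
            nlinarith [sq_nonneg s]
          nlinarith [mul_le_mul_of_nonneg_left h2 hn]

/-- A finite covering number is attained. -/
lemma exists_finset_of_coveringNumber_le {d : Θ → Θ → ℝ} {r : ℝ} {A : Set Θ} {K : ℝ≥0∞}
    (hK : K ≠ ∞) (h : (coveringNumber d r A : ℝ≥0∞) ≤ K) :
    ∃ F : Finset Θ, (∀ θ ∈ A, ∃ c ∈ F, d θ c ≤ r) ∧ (F.card : ℝ≥0∞) ≤ K := by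
  have hne : coveringNumber d r A ≠ ⊤ := by
    intro h'
    rw [h'] at h
    exact hK (top_le_iff.1 (by simpa using h))
  have hcov : ∃ F : Finset Θ, ∀ θ ∈ A, ∃ c ∈ F, d θ c ≤ r := by
    by_contra! hno
    apply hne
    simp only [coveringNumber, iInf_eq_top]
    intro F hF
    obtain ⟨θ, hθ, hc⟩ := hno F
    obtain ⟨c, hcF, hle⟩ := hF θ hθ
    exact absurd hle (not_le.2 (hc c hcF))
  have : Nonempty {F : Finset Θ // ∀ θ ∈ A, ∃ c ∈ F, d θ c ≤ r} :=
    nonempty_subtype.2 hcov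
  obtain ⟨F, hF⟩ := ENat.exists_eq_iInf
    fun F : {F : Finset Θ // ∀ θ ∈ A, ∃ c ∈ F, d θ c ≤ r} => (F.1.card : ℕ∞)
  refine ⟨F.1, F.2, ?_⟩
  have hF' : (F.1.card : ℕ∞) = coveringNumber d r A := by
    rw [hF, coveringNumber, iInf_subtype]
  rw [← hF'] at h
  simpa using h

end ShellTest

/-! ### Likelihood ratios on the Kullback–Leibler ball -/

section Evidence
variable {Θ 𝓧 : Type*} [MeasurableSpace 𝓧] {ν : Measure 𝓧} {p : Θ → 𝓧 → ℝ≥0}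

/-- The first two moments of the log-likelihood ratio on a Kullback–Leibler neighbourhood. -/
lemma log_ratio_moments_of_mem_klBall [SigmaFinite ν] (hp : ∀ θ, Measurable (p θ))
    (hp_one : ∀ θ, ∫⁻ x, (p θ x : ℝ≥0∞) ∂ν = 1) {n : ℕ} (hn : n ≠ 0) {θ₀ θ : Θ} {ε : ℝ}
    (hθ : θ ∈ klBall ν p n θ₀ ε) :
    (∀ᵐ y ∂law ν p θ₀, p θ₀ y ≠ 0 ∧ p θ y ≠ 0) ∧
    MemLp (fun y => Real.log ((p θ₀ y : ℝ) / p θ y)) 2 (law ν p θ₀) ∧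
    ∫ y, Real.log ((p θ₀ y : ℝ) / p θ y) ∂law ν p θ₀ ≤ ε ^ 2 ∧
    ∫ y, Real.log ((p θ₀ y : ℝ) / p θ y) ^ 2 ∂law ν p θ₀ ≤ ε ^ 2 := by
  have := isProbabilityMeasure_law hp_one θ₀
  have := isProbabilityMeasure_law hp_one θ
  have hn0 : (0 : ℝ) < n := by exact_mod_cast Nat.pos_of_ne_zero hn
  obtain ⟨hkl, hV⟩ := hθ
  simp only [Finset.sum_const, Finset.card_univ, Fintype.card_fin, nsmul_eq_mul] at hkl hV
  have hV' : V₂ ν p θ₀ θ ≤ ENNReal.ofReal (ε ^ 2) := by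
    rwa [← mul_assoc, one_div, ENNReal.inv_mul_cancel (by simpa using hn) (by simp),
      one_mul] at hV
  have hkl' : InformationTheory.klDiv (law ν p θ₀) (law ν p θ) ≤ ENNReal.ofReal (ε ^ 2) := by
    rw [ENNReal.ofReal_mul hn0.le, ENNReal.ofReal_natCast] at hkl
    exact (ENNReal.mul_le_mul_iff_right (by simpa using hn) (by simp)).1 hkl
  obtain ⟨hac, hint⟩ := InformationTheory.klDiv_ne_top_iff.1
    (hkl'.trans_lt ENNReal.ofReal_lt_top).ne
  -- Finite divergence forces `P_θ₀ ≪ P_θ`, so both densities are almost surely positive and the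
  -- extended logarithm is the real one.
  have hpos : ∀ᵐ y ∂law ν p θ₀, p θ₀ y ≠ 0 ∧ p θ y ≠ 0 :=
    (ae_law_ne_zero hp θ₀).and (hac.ae_le (ae_law_ne_zero hp θ))
  have hlawν (t : Θ) : law ν p t ≪ ν := withDensity_absolutelyContinuous _ _
  have hllr : llr (law ν p θ₀) (law ν p θ) =ᵐ[law ν p θ₀]
      fun y => Real.log ((p θ₀ y : ℝ) / p θ y) := by
    have h1 := hac.ae_le (Measure.rnDeriv_eq_div (hlawν θ₀) (hlawν θ))
    have h2 := (hlawν θ₀).ae_le (Measure.rnDeriv_withDensity ν (hp θ₀).coe_nnreal_ennreal)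
    have h3 := (hlawν θ₀).ae_le (Measure.rnDeriv_withDensity ν (hp θ).coe_nnreal_ennreal)
    filter_upwards [h1, h2, h3] with y h1 h2 h3
    have h1' : (law ν p θ₀).rnDeriv (law ν p θ) y = (p θ₀ y : ℝ≥0∞) / (p θ y : ℝ≥0∞) := by
      rw [h1]; unfold law; rw [h2, h3]
    simp [llr_def, h1']
  have hYm : Measurable fun y => Real.log ((p θ₀ y : ℝ) / p θ y) :=
    ((hp θ₀).coe_nnreal_real.div (hp θ).coe_nnreal_real).log
  have hsq : ∫⁻ y, ENNReal.ofReal (Real.log ((p θ₀ y : ℝ) / p θ y) ^ 2) ∂law ν p θ₀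
      ≤ ENNReal.ofReal (ε ^ 2) := by
    refine le_trans (le_of_eq ?_) hV'
    rw [V₂, ← lintegral_law hp]
    refine lintegral_congr_ae ?_
    filter_upwards [hpos] with y hy
    have hq : (p θ₀ y : ℝ≥0∞) / (p θ y : ℝ≥0∞) = ((p θ₀ y / p θ y : ℝ≥0) : ℝ≥0∞) :=
      (ENNReal.coe_div hy.2).symm
    rw [hq, ENNReal.log_of_nnreal (div_ne_zero hy.1 hy.2), EReal.abs_def,
      ← ENNReal.ofReal_pow (abs_nonneg _), sq_abs]
    simp
  have hsqi : Integrable (fun y => Real.log ((p θ₀ y : ℝ) / p θ y) ^ 2) (law ν p θ₀) := by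
    refine ⟨(hYm.pow_const 2).aestronglyMeasurable, ?_⟩
    rw [hasFiniteIntegral_iff_ofReal (ae_of_all _ fun y => sq_nonneg _)]
    exact hsq.trans_lt ENNReal.ofReal_lt_top
  refine ⟨hpos, (memLp_two_iff_integrable_sq hYm.aestronglyMeasurable).2 hsqi, ?_, ?_⟩
  · rw [← integral_congr_ae hllr, ← InformationTheory.toReal_klDiv_of_measure_eq hac (by simp)]
    exact ENNReal.toReal_le_of_le_ofReal (sq_nonneg ε) hkl'
  · rw [integral_eq_lintegral_of_nonneg_ae (ae_of_all _ fun y => sq_nonneg _)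
      (hYm.pow_const 2).aestronglyMeasurable]
    exact ENNReal.toReal_le_of_le_ofReal (sq_nonneg ε) hsq

/-- Chebyshev: the summed log-ratio has mean and variance at most `n ε²`, and the event asks it to
exceed `2 n ε²`. -/
lemma sampleLaw_likelihood_ratio_lt_le [SigmaFinite ν] (hp : ∀ θ, Measurable (p θ))
    (hp_one : ∀ θ, ∫⁻ x, (p θ x : ℝ≥0∞) ∂ν = 1) {n : ℕ} (hn : n ≠ 0) {θ₀ θ : Θ} {ε : ℝ}
    (hε : 0 < ε) (hθ : θ ∈ klBall ν p n θ₀ ε) :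
    sampleLaw ν p n θ₀ {x | likelihood p θ x / likelihood p θ₀ x
      < ENNReal.ofReal (Real.exp (-(2 * (n * ε ^ 2))))} ≤ ENNReal.ofReal (1 / (n * ε ^ 2)) := by
  have := isProbabilityMeasure_law hp_one θ₀
  have := isProbabilityMeasure_sampleLaw hp_one n θ₀
  have hn0 : (0 : ℝ) < n := by exact_mod_cast Nat.pos_of_ne_zero hn
  obtain ⟨hpos, hL2, hmean, hvar⟩ := log_ratio_moments_of_mem_klBall hp hp_one hn hθ
  set Y : 𝓧 → ℝ := fun y => Real.log ((p θ₀ y : ℝ) / p θ y) with hY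
  have hYi : Integrable Y (law ν p θ₀) := hL2.integrable (by norm_num)
  have hmp (i : Fin n) := measurePreserving_eval (fun _ : Fin n => law ν p θ₀) i
  set Z : (Fin n → 𝓧) → ℝ := ∑ i, fun x => Y (x i) with hZ
  have hZL2 : MemLp Z 2 (sampleLaw ν p n θ₀) :=
    memLp_finsetSum' _ fun i _ => hL2.comp_measurePreserving (hmp i)
  have hZmean : ∫ x, Z x ∂sampleLaw ν p n θ₀ ≤ n * ε ^ 2 := by
    have h1 (i : Fin n) : ∫ x, Y (x i) ∂sampleLaw ν p n θ₀ = ∫ y, Y y ∂law ν p θ₀ := by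
      rw [← (hmp i).map_eq, integral_map (hmp i).measurable.aemeasurable]
      · rfl
      · rw [(hmp i).map_eq]; exact hYi.1
    simp only [hZ, Finset.sum_apply]
    have h2 (i : Fin n) : Integrable (fun x : Fin n → 𝓧 => Y (x i)) (sampleLaw ν p n θ₀) :=
      (hmp i).integrable_comp_of_integrable hYi
    rw [integral_finsetSum _ fun i _ => h2 i]
    simp only [h1, Finset.sum_const, Finset.card_univ, Fintype.card_fin, nsmul_eq_mul]
    gcongr
  have hZvar : ProbabilityTheory.variance Z (sampleLaw ν p n θ₀) ≤ n * ε ^ 2 := by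
    rw [hZ, sampleLaw, ProbabilityTheory.variance_sum_pi fun _ => hL2]
    simp only [Finset.sum_const, Finset.card_univ, Fintype.card_fin, nsmul_eq_mul]
    gcongr
    exact (ProbabilityTheory.variance_le_expectation_sq hL2.1).trans hvar
  have hnε : 0 < n * ε ^ 2 := by positivity
  calc _ ≤ sampleLaw ν p n θ₀ {x | n * ε ^ 2 ≤ |Z x - ∫ x, Z x ∂sampleLaw ν p n θ₀|} := by
        refine measure_mono_ae ?_
        filter_upwards [ae_sampleLaw_of_ae_law hp_one n θ₀ hpos] with x hx hlt
        change likelihood p θ x / likelihood p θ₀ x < _ at hlt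
        change n * ε ^ 2 ≤ |Z x - _|
        have hratio : likelihood p θ x / likelihood p θ₀ x
            = ENNReal.ofReal (Real.exp (-Z x)) := by
          have h1 (i : Fin n) : Real.exp (-Y (x i)) = ((p θ (x i) / p θ₀ (x i) : ℝ≥0) : ℝ) := by
            have h2 : (0 : ℝ) < p θ₀ (x i) := NNReal.coe_pos.2 (pos_iff_ne_zero.2 (hx i).1)
            have h3 : (0 : ℝ) < p θ (x i) := NNReal.coe_pos.2 (pos_iff_ne_zero.2 (hx i).2)
            rw [hY, ← Real.log_inv, Real.exp_log (by positivity)]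
            simp
          rw [hZ, Finset.sum_apply, ← Finset.sum_neg_distrib, Real.exp_sum]
          simp only [h1]
          rw [← NNReal.coe_prod, ENNReal.ofReal_coe_nnreal, Finset.prod_div_distrib,
            ENNReal.coe_div (Finset.prod_ne_zero_iff.2 fun i _ => (hx i).1),
            ENNReal.ofNNReal_finsetProd, ENNReal.ofNNReal_finsetProd]
          rfl
        rw [hratio, ENNReal.ofReal_lt_ofReal_iff (Real.exp_pos _), Real.exp_lt_exp] at hlt
        refine le_trans ?_ (le_abs_self _)
        linarith
    _ ≤ ENNReal.ofReal (ProbabilityTheory.variance Z (sampleLaw ν p n θ₀) / (n * ε ^ 2) ^ 2) :=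
        ProbabilityTheory.meas_ge_le_variance_div_sq hZL2 hnε
    _ ≤ _ := by
        apply ENNReal.ofReal_le_ofReal
        rw [div_le_div_iff₀ (by positivity) hnε]
        nlinarith

end Evidence

/-! ### Removing the residual -/

section Residual
variable {Θ 𝓧 : Type*} [MeasurableSpace Θ]

lemma pseudoPosterior_le_one (p : Θ → 𝓧 → ℝ≥0) (θ₀ : Θ) (π : Measure Θ) {n : ℕ}
    (x : Fin n → 𝓧) (u : Θ → EReal) (U : Set Θ) : pseudoPosterior p θ₀ π x u U ≤ 1 := by
  refine ENNReal.div_le_of_le_mul ?_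
  rw [one_mul]
  exact setLIntegral_le_lintegral _ _

/-- A uniform bound on the residual costs at most a factor `exp (2 L)`. -/
lemma pseudoPosterior_le_of_abs_le (p : Θ → 𝓧 → ℝ≥0) (θ₀ : Θ) (π : Measure Θ) {n : ℕ}
    (x : Fin n → 𝓧) (u : Θ → EReal) (U : Set Θ) {L : ℝ}
    (hu : ∀ θ, ((u θ).abs : EReal) ≤ L) :
    pseudoPosterior p θ₀ π x u U ≤ ENNReal.ofReal (Real.exp (2 * L)) *
      ((∫⁻ θ in U, likelihood p θ x / likelihood p θ₀ x ∂π) /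
        ∫⁻ θ, likelihood p θ x / likelihood p θ₀ x ∂π) := by
  have hexp (θ : Θ) : ENNReal.ofReal (Real.exp (-L)) ≤ EReal.exp (u θ) ∧
      EReal.exp (u θ) ≤ ENNReal.ofReal (Real.exp L) := by
    have h := hu θ
    induction hv : u θ with
    | bot => simp [hv] at h
    | top => simp [hv] at h
    | coe v =>
      rw [hv, EReal.coe_abs, EReal.coe_le_coe_iff, abs_le] at h
      simp only [EReal.exp_coe]
      exact ⟨ENNReal.ofReal_le_ofReal (Real.exp_le_exp.2 h.1),
        ENNReal.ofReal_le_ofReal (Real.exp_le_exp.2 h.2)⟩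
  have hnum : ∫⁻ θ in U, likelihood p θ x / likelihood p θ₀ x * EReal.exp (u θ) ∂π
      ≤ ENNReal.ofReal (Real.exp L) * ∫⁻ θ in U, likelihood p θ x / likelihood p θ₀ x ∂π := by
    rw [← lintegral_const_mul' _ _ ENNReal.ofReal_ne_top]
    refine lintegral_mono fun θ => ?_
    rw [mul_comm]
    gcongr
    exact (hexp θ).2
  have hden : ENNReal.ofReal (Real.exp (-L)) * ∫⁻ θ, likelihood p θ x / likelihood p θ₀ x ∂π
      ≤ ∫⁻ θ, likelihood p θ x / likelihood p θ₀ x * EReal.exp (u θ) ∂π := by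
    rw [← lintegral_const_mul' _ _ ENNReal.ofReal_ne_top]
    refine lintegral_mono fun θ => ?_
    rw [mul_comm]
    gcongr
    exact (hexp θ).1
  refine (ENNReal.div_le_div hnum hden).trans_eq ?_
  have h1 : ENNReal.ofReal (Real.exp (-L)) ≠ 0 := by simp [Real.exp_pos]
  rw [div_eq_mul_inv, ENNReal.mul_inv (Or.inl h1) (Or.inl ENNReal.ofReal_ne_top),
    ← ENNReal.ofReal_inv_of_pos (Real.exp_pos _), ← Real.exp_neg, neg_neg, two_mul, Real.exp_add,
    ENNReal.ofReal_mul (Real.exp_nonneg _), div_eq_mul_inv]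
  ring

end Residual

/-! ### Evidence bound and expected posterior mass -/

section Posterior
variable {Θ 𝓧 : Type*} [MeasurableSpace Θ] [MeasurableSpace 𝓧] {ν : Measure 𝓧}
  {p : Θ → 𝓧 → ℝ≥0}

lemma measurable_likelihood_ratio (hp : Measurable (Function.uncurry p)) (n : ℕ) (θ₀ : Θ) :
    Measurable fun q : Θ × (Fin n → 𝓧) => likelihood p q.1 q.2 / likelihood p θ₀ q.2 := by
  refine Measurable.div ?_ ?_
  · refine Finset.measurable_prod _ fun i _ => Measurable.coe_nnreal_ennreal ?_
    exact hp.comp (measurable_fst.prodMk ((measurable_pi_apply i).comp measurable_snd))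
  · refine Finset.measurable_prod _ fun i _ => Measurable.coe_nnreal_ennreal ?_
    exact hp.of_uncurry_left.comp ((measurable_pi_apply i).comp measurable_snd)

/-- The evidence lower bound. -/
lemma sampleLaw_evidence_lt_le [SigmaFinite ν] (hp : Measurable (Function.uncurry p))
    (hp_one : ∀ θ, ∫⁻ x, (p θ x : ℝ≥0∞) ∂ν = 1) (π : Measure Θ) [IsProbabilityMeasure π]
    {n : ℕ} (hn : n ≠ 0) (θ₀ : Θ) {ε : ℝ} (hε : 0 < ε) :
    sampleLaw ν p n θ₀ {x | ∫⁻ θ, likelihood p θ x / likelihood p θ₀ x ∂π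
        < π (klBall ν p n θ₀ ε) / 2 * ENNReal.ofReal (Real.exp (-(2 * (n * ε ^ 2))))}
      ≤ 2 * ENNReal.ofReal (1 / (n * ε ^ 2)) := by
  have hpm (θ : Θ) : Measurable (p θ) := hp.of_uncurry_left
  have := isProbabilityMeasure_sampleLaw hp_one n θ₀
  set B := klBall ν p n θ₀ ε with hB
  set K := ENNReal.ofReal (Real.exp (-(2 * (n * ε ^ 2)))) with hK
  have hK0 : K ≠ 0 := by simp [hK, Real.exp_pos]
  have hKtop : K ≠ ∞ := ENNReal.ofReal_ne_top
  have hR := measurable_likelihood_ratio hp n θ₀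
  by_cases hB0 : π B = 0
  · simp [hB0]
  have hBtop : π B ≠ ∞ := measure_ne_top _ _
  set T := π.restrict B with hT
  have hTuniv : T univ = π B := by simp [hT]
  set bad : Set (Θ × (Fin n → 𝓧)) := {q | likelihood p q.1 q.2 / likelihood p θ₀ q.2 < K} with hbad
  have hbadm : MeasurableSet bad := measurableSet_lt hR measurable_const
  -- Good parameters contribute at least `K` per unit of prior mass, so small evidence leaves them
  -- less than half of `B`; the bad ones hold the rest. Fubini and Markov then make this unlikely.
  have hsub : {x | ∫⁻ θ, likelihood p θ x / likelihood p θ₀ x ∂π < π B / 2 * K}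
      ⊆ {x | π B / 2 ≤ T ((fun θ => (θ, x)) ⁻¹' bad)} := by
    intro x hx
    change ∫⁻ θ, likelihood p θ x / likelihood p θ₀ x ∂π < π B / 2 * K at hx
    change π B / 2 ≤ T ((fun θ => (θ, x)) ⁻¹' bad)
    have hbx : MeasurableSet ((fun θ => (θ, x)) ⁻¹' bad) := measurable_prodMk_right hbadm
    have hgood : K * T ((fun θ => (θ, x)) ⁻¹' bad)ᶜ < π B / 2 * K := by
      refine lt_of_le_of_lt ?_ hx
      refine le_trans ?_ (lintegral_mono' (Measure.restrict_le_self (s := B)) le_rfl)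
      refine le_trans (le_of_eq ?_) (mul_meas_ge_le_lintegral₀
        (hR.comp measurable_prodMk_right).aemeasurable K)
      congr 2
      ext θ
      simp [hbad]
    rw [mul_comm, ENNReal.mul_lt_mul_iff_left hK0 hKtop] at hgood
    by_contra! hlt
    have h1 := ENNReal.add_lt_add hlt hgood
    rw [measure_add_measure_compl hbx, hTuniv, ENNReal.add_halves] at h1
    exact lt_irrefl _ h1
  have hmean : ∫⁻ x, T ((fun θ => (θ, x)) ⁻¹' bad) ∂sampleLaw ν p n θ₀
      ≤ ENNReal.ofReal (1 / (n * ε ^ 2)) * π B := by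
    rw [← Measure.prod_apply_symm hbadm, Measure.prod_apply hbadm]
    have hae : ∀ᵐ θ ∂T, sampleLaw ν p n θ₀ (Prod.mk θ ⁻¹' bad)
        ≤ ENNReal.ofReal (1 / (n * ε ^ 2)) := by
      -- Measurability of the predicate suffices here; none is required of `B`.
      rw [hT, ae_restrict_iff (measurableSet_le (measurable_measure_prodMk_left hbadm)
        measurable_const)]
      exact ae_of_all _ fun θ hθ => sampleLaw_likelihood_ratio_lt_le hpm hp_one hn hε hθ
    refine (lintegral_mono_ae hae).trans_eq ?_
    rw [lintegral_const, hTuniv]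
  refine (measure_mono hsub).trans ?_
  refine (meas_ge_le_lintegral_div (measurable_measure_prodMk_right hbadm).aemeasurable
    (by simpa using hB0) (ENNReal.div_ne_top hBtop (by simp))).trans ?_
  refine ENNReal.div_le_of_le_mul (hmean.trans_eq ?_)
  rw [mul_comm 2, mul_assoc, ENNReal.mul_div_cancel (by simp) (by simp)]

/-- The expected pseudo-posterior mass of a set in terms of the residual event, the evidence
event, and a test. -/
lemma lintegral_pseudoPosterior_le [SigmaFinite ν] (hp : Measurable (Function.uncurry p))
    (hp_one : ∀ θ, ∫⁻ x, (p θ x : ℝ≥0∞) ∂ν = 1) (π : Measure Θ) [IsProbabilityMeasure π]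
    {n : ℕ} (hn : n ≠ 0) (θ₀ : Θ) {ε : ℝ} (hε : 0 < ε)
    {Ω : Type*} [MeasurableSpace Ω] (ρ : Measure Ω) [IsProbabilityMeasure ρ]
    (u : Θ → (Fin n → 𝓧) × Ω → EReal) (L : ℝ) (U : Set Θ)
    {Φ : Set (Fin n → 𝓧)} (hΦ : MeasurableSet Φ) :
    ∫⁻ ω, pseudoPosterior p θ₀ π ω.1 (fun θ => u θ ω) U ∂(sampleLaw ν p n θ₀).prod ρ ≤
      (sampleLaw ν p n θ₀).prod ρ {ω | ¬ ∀ θ, ((u θ ω).abs : EReal) ≤ L}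
      + 2 * ENNReal.ofReal (1 / (n * ε ^ 2)) + sampleLaw ν p n θ₀ Φ
      + ENNReal.ofReal (Real.exp (2 * L))
        * ((∫⁻ x in Φᶜ, ∫⁻ θ in U, likelihood p θ x / likelihood p θ₀ x ∂π ∂sampleLaw ν p n θ₀)
          / (π (klBall ν p n θ₀ ε) / 2 * ENNReal.ofReal (Real.exp (-(2 * (n * ε ^ 2)))))) := by
  have := isProbabilityMeasure_sampleLaw hp_one n θ₀
  set μ := sampleLaw ν p n θ₀ with hμ
  set e := π (klBall ν p n θ₀ ε) / 2 * ENNReal.ofReal (Real.exp (-(2 * (n * ε ^ 2)))) with he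
  have hR := measurable_likelihood_ratio hp n θ₀
  set A := {ω | ¬ ∀ θ, ((u θ ω).abs : EReal) ≤ L} with hA
  set E := {x : Fin n → 𝓧 | ∫⁻ θ, likelihood p θ x / likelihood p θ₀ x ∂π < e} with hE
  have hEm : MeasurableSet E := measurableSet_lt hR.lintegral_prod_left' measurable_const
  set N : (Fin n → 𝓧) → ℝ≥0∞ := fun x =>
    ∫⁻ θ in U, likelihood p θ x / likelihood p θ₀ x ∂π with hN
  have hNm : Measurable N := hR.lintegral_prod_left'
  set g : (Fin n → 𝓧) → ℝ≥0∞ := fun x => E.indicator 1 x + Φ.indicator 1 x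
    + ENNReal.ofReal (Real.exp (2 * L)) * (Φᶜ.indicator N x / e) with hg
  have hEΦ : Measurable fun x => E.indicator (1 : (Fin n → 𝓧) → ℝ≥0∞) x + Φ.indicator 1 x :=
    (measurable_one.indicator hEm).add (measurable_one.indicator hΦ)
  have hgm : Measurable g := hEΦ.add
    (((hNm.indicator hΦ.compl).div_const _).const_mul _)
  -- On the three exceptional events the trivial bound one is used. `A` quantifies over all `θ` and
  -- need not be measurable, hence its measurable hull.
  have hpt (ω : (Fin n → 𝓧) × Ω) : pseudoPosterior p θ₀ π ω.1 (fun θ => u θ ω) U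
      ≤ (toMeasurable (μ.prod ρ) A).indicator 1 ω + g ω.1 := by
    by_cases h1 : ω ∈ A
    · rw [indicator_of_mem (subset_toMeasurable _ _ h1)]
      exact (pseudoPosterior_le_one ..).trans le_self_add
    refine le_trans ?_ le_add_self
    by_cases h2 : ω.1 ∈ E
    · simp only [hg, indicator_of_mem h2, add_assoc]
      exact (pseudoPosterior_le_one ..).trans le_self_add
    by_cases h3 : ω.1 ∈ Φ
    · simp only [hg, indicator_of_mem h3]
      exact (pseudoPosterior_le_one ..).trans (le_add_self.trans le_self_add)
    refine le_trans ?_ (le_add_self : _ ≤ g ω.1)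
    rw [indicator_of_mem (show ω.1 ∈ Φᶜ from h3)]
    refine (pseudoPosterior_le_of_abs_le p θ₀ π ω.1 _ U (not_not.1 h1)).trans ?_
    gcongr
    exact not_lt.1 h2
  calc _ ≤ ∫⁻ ω, (toMeasurable (μ.prod ρ) A).indicator 1 ω + g ω.1 ∂μ.prod ρ :=
        lintegral_mono hpt
    _ = (μ.prod ρ) A + ∫⁻ x, g x ∂μ := by
        rw [lintegral_add_left (measurable_one.indicator (measurableSet_toMeasurable _ _)),
          lintegral_indicator_one (measurableSet_toMeasurable _ _), measure_toMeasurable]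
        congr 1
        exact measurePreserving_fst.lintegral_comp hgm
    _ = (μ.prod ρ) A + (μ E + μ Φ + ENNReal.ofReal (Real.exp (2 * L))
          * ((∫⁻ x in Φᶜ, N x ∂μ) / e)) := by
        congr 1
        simp only [hg]
        rw [lintegral_add_left hEΦ,
          lintegral_add_left (measurable_one.indicator hEm), lintegral_indicator_one hEm,
          lintegral_indicator_one hΦ, lintegral_const_mul' _ _ ENNReal.ofReal_ne_top]
        simp only [div_eq_mul_inv]
        rw [lintegral_mul_const _ (hNm.indicator hΦ.compl), lintegral_indicator hΦ.compl]
    _ ≤ _ := by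
        rw [← add_assoc, ← add_assoc]
        gcongr
        exact sampleLaw_evidence_lt_le hp hp_one π hn θ₀ hε

end Posterior

lemma abs_le_of_abs_div_le {x : ℝ≥0∞} {n : ℕ} (hn : n ≠ 0) {c : ℝ}
    (h : ((x / (n : ℝ≥0∞) : ℝ≥0∞) : EReal) ≤ (c : EReal)) :
    (x : EReal) ≤ ((n * c : ℝ) : EReal) := by
  have hn0 : (0 : ℝ) < n := by exact_mod_cast Nat.pos_of_ne_zero hn
  induction x with
  | top =>
    rw [ENNReal.top_div_of_ne_top (by simp)] at h
    simp at h
  | coe y =>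
    have h1 : (y : ℝ≥0∞) / (n : ℝ≥0∞) = ((y / n : ℝ≥0) : ℝ≥0∞) := by
      rw [ENNReal.coe_div (by exact_mod_cast hn), ENNReal.coe_natCast]
    rw [h1, EReal.coe_nnreal_eq_coe_real, EReal.coe_le_coe_iff] at h
    rw [EReal.coe_nnreal_eq_coe_real, EReal.coe_le_coe_iff]
    rw [NNReal.coe_div, div_le_iff₀ (by simpa using hn0), mul_comm] at h
    simpa using h

/-- `∑ k ≥ J, e⁻ᵏ`, as an extended nonnegative real. -/
def expTail (J : ℕ) : ℝ≥0∞ := ∑' k : ℕ, ENNReal.ofReal (Real.exp (-((J + k : ℕ) : ℝ)))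

lemma tendsto_expTail : Tendsto expTail atTop (𝓝 0) := by
  have h : ∑' k : ℕ, ENNReal.ofReal (Real.exp (-(k : ℝ))) ≠ ∞ := by
    have h1 (k : ℕ) : ENNReal.ofReal (Real.exp (-(k : ℝ))) = ENNReal.ofReal (Real.exp (-1)) ^ k := by
      rw [← ENNReal.ofReal_pow (Real.exp_nonneg _), ← Real.exp_nat_mul, mul_neg_one]
    simp only [h1]
    rw [ENNReal.tsum_geometric]
    refine ENNReal.inv_ne_top.2 (tsub_pos_of_lt ?_).ne'
    rw [ENNReal.ofReal_lt_one]
    simp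
  have := ENNReal.tendsto_sum_nat_add (fun k : ℕ => ENNReal.ofReal (Real.exp (-(k : ℝ)))) h
  refine this.congr fun J => ?_
  simp only [expTail, add_comm]

/-! ### Shells and their tests -/

section Contraction
variable {Θ 𝓧 : Type*} [MeasurableSpace 𝓧] {ν : Measure 𝓧} {p : Θ → 𝓧 → ℝ≥0}

/-- The part of the sieve `S` at Hellinger distance between `j ε` and `2 j ε` from `θ₀`. -/
def shell (ν : Measure 𝓧) (p : Θ → 𝓧 → ℝ≥0) (n : ℕ) (θ₀ : Θ) (S : Set Θ) (ε : ℝ) (j : ℕ) :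
    Set Θ :=
  {θ ∈ S | (j : ℝ) * ε < hellinger ν p n θ θ₀ ∧ hellinger ν p n θ θ₀ ≤ 2 * (j : ℝ) * ε}

/-- The index is `j = ⌈d/ε⌉ - 1`: then `j < d/ε ≤ j + 1 ≤ 2j`, the last step by `J ≥ 1`. -/
lemma subset_iUnion_shell (ν : Measure 𝓧) (p : Θ → 𝓧 → ℝ≥0) (n : ℕ) (θ₀ : Θ) (S : Set Θ)
    {ε : ℝ} (hε : 0 < ε) {J : ℕ} (hJ : 1 ≤ J) {M : ℝ} (hM : (J : ℝ) ≤ M) :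
    {θ | M * ε < hellinger ν p n θ θ₀} ⊆ Sᶜ ∪ ⋃ k : ℕ, shell ν p n θ₀ S ε (J + k) := by
  intro θ hθ
  by_cases hS : θ ∈ S
  swap
  · exact Or.inl hS
  refine Or.inr (mem_iUnion.2 ?_)
  set t := hellinger ν p n θ θ₀ / ε with ht
  have hd : hellinger ν p n θ θ₀ = t * ε := by rw [ht]; field_simp
  have hJt : (J : ℝ) < t := by
    rw [ht, lt_div_iff₀ hε]
    refine lt_of_le_of_lt ?_ hθ
    gcongr
  have ht0 : 0 ≤ t := (Nat.cast_nonneg J).trans hJt.le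
  have hceil : J + 1 ≤ ⌈t⌉₊ := Nat.lt_ceil.2 hJt
  obtain ⟨k, hk⟩ := Nat.exists_eq_add_of_le hceil
  have h1 : ((J + k : ℕ) : ℝ) < t := by
    apply Nat.lt_ceil.1; omega
  have h2 : t ≤ 2 * ((J + k : ℕ) : ℝ) := by
    refine (Nat.le_ceil t).trans ?_
    rw [hk]
    exact_mod_cast (by omega : J + 1 + k ≤ 2 * (J + k))
  refine ⟨k, hS, ?_, ?_⟩
  · rw [hd]; gcongr
  · rw [hd]; gcongr

/-- Tests of `θ₀` against a shell, under the local entropy condition. -/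
lemma exists_shell_test (hp : ∀ θ, Measurable (p θ))
    (hp_one : ∀ θ, ∫⁻ x, (p θ x : ℝ≥0∞) ∂ν = 1) {n : ℕ} (hn : n ≠ 0) (θ₀ : Θ) (S : Set Θ)
    {ε : ℝ} (hε : 0 < ε) {H : ℝ}
    (h_entropy : (⨆ r ∈ Ioi ε, ENNReal.log (coveringNumber (hellinger ν p n) (r / 36)
            {θ ∈ S | hellinger ν p n θ θ₀ < r} : ℝ≥0∞) : EReal) ≤ (H : EReal))
    {j : ℕ} (hj : 1 ≤ j) :
    ∃ Φ : Set (Fin n → 𝓧), MeasurableSet Φ ∧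
      sampleLaw ν p n θ₀ Φ ≤ ENNReal.ofReal (Real.exp H)
        * ENNReal.ofReal (Real.exp (-(n * (j * ε) ^ 2 / 6))) ∧
      ∀ θ ∈ shell ν p n θ₀ S ε j,
        ∫⁻ x in Φᶜ, likelihood p θ x / likelihood p θ₀ x ∂sampleLaw ν p n θ₀
          ≤ ENNReal.ofReal (Real.exp (-(n * (j * ε) ^ 2 / 3))) := by
  have hj' : (1 : ℝ) ≤ j := by exact_mod_cast hj
  have hjε : 0 < j * ε := by positivity
  -- `r / 36` is the radius `s / 17` needed for `s = jε`, and `36/17 > 2` puts the shell inside the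
  -- open ball of radius `r`.
  set r := 36 * (j * ε / 17) with hr
  have hrε : ε < r := by nlinarith
  have hcov : (coveringNumber (hellinger ν p n) (r / 36)
      {θ ∈ S | hellinger ν p n θ θ₀ < r} : ℝ≥0∞) ≤ ENNReal.ofReal (Real.exp H) := by
    have h1 := (le_iSup₂ (f := fun r (_ : r ∈ Ioi ε) =>
      ENNReal.log (coveringNumber (hellinger ν p n) (r / 36)
            {θ ∈ S | hellinger ν p n θ θ₀ < r} : ℝ≥0∞)) r hrε).trans h_entropy
    have h2 := EReal.exp_monotone h1
    rwa [ENNReal.exp_log, EReal.exp_coe] at h2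
  obtain ⟨F, hF, hcard⟩ := exists_finset_of_coveringNumber_le ENNReal.ofReal_ne_top hcov
  have hfar : ∀ θ ∈ shell ν p n θ₀ S ε j, (j * ε) ^ 2 ≤ sqHellinger ν (p θ) (p θ₀) := by
    rintro θ ⟨-, hlt, -⟩
    rw [hellinger_eq_sqrt ν p hn] at hlt
    exact ((Real.lt_sqrt hjε.le).1 hlt).le
  have hnear : ∀ θ ∈ shell ν p n θ₀ S ε j,
      ∃ c ∈ F, 289 * sqHellinger ν (p θ) (p c) ≤ (j * ε) ^ 2 := by
    rintro θ ⟨hS, -, hle⟩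
    obtain ⟨c, hc, hd⟩ := hF θ ⟨hS, by nlinarith⟩
    refine ⟨c, hc, ?_⟩
    rw [hellinger_eq_sqrt ν p hn, Real.sqrt_le_left (by positivity)] at hd
    nlinarith
  obtain ⟨Φ, hΦ, h1, h2⟩ := exists_test_of_cover hp hp_one n θ₀ hfar F hnear
  exact ⟨Φ, hΦ, h1.trans (by gcongr), h2⟩

end Contraction

/-! ### Non-asymptotic bound -/

section Bound
variable {Θ 𝓧 : Type*} [MeasurableSpace Θ] [MeasurableSpace 𝓧] {ν : Measure 𝓧}
  {p : Θ → 𝓧 → ℝ≥0}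

/-- The non-asymptotic form of the contraction theorem. -/
lemma lintegral_pseudoPosterior_compl_ball_le [SigmaFinite ν]
    (hp : Measurable (Function.uncurry p)) (hp_one : ∀ θ, ∫⁻ x, (p θ x : ℝ≥0∞) ∂ν = 1)
    (π : Measure Θ) [IsProbabilityMeasure π] {n : ℕ} (hn : n ≠ 0) (θ₀ : Θ) {ε : ℝ} (hε : 0 < ε)
    {Ω : Type*} [MeasurableSpace Ω] (ρ : Measure Ω) [IsProbabilityMeasure ρ]
    (u : Θ → (Fin n → 𝓧) × Ω → EReal) (S : Set Θ) {C M : ℝ} {J : ℕ}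
    (hnε : 1 ≤ n * ε ^ 2) (hJ : 61 ≤ J) (hJM : (J : ℝ) ≤ M) (hC : C ≤ 2 * J)
    (h_entropy : (⨆ r ∈ Ioi ε, ENNReal.log (coveringNumber (hellinger ν p n) (r / 36)
            {θ ∈ S | hellinger ν p n θ θ₀ < r} : ℝ≥0∞) : EReal) ≤ ((n * ε ^ 2 : ℝ) : EReal))
    (h_shell : ∀ j : ℕ, J ≤ j → π (shell ν p n θ₀ S ε j) / π (klBall ν p n θ₀ ε)
        ≤ ENNReal.ofReal (Real.exp (n * ε ^ 2 * (j : ℝ) ^ 2 / 4))) :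
    ∫⁻ ω, pseudoPosterior p θ₀ π ω.1 (fun θ => u θ ω) {θ | M * ε < hellinger ν p n θ θ₀}
        ∂(sampleLaw ν p n θ₀).prod ρ ≤
      (sampleLaw ν p n θ₀).prod ρ {ω | ¬ ∀ θ, ((u θ ω).abs : EReal) ≤ (n * (C * ε ^ 2) : ℝ)}
      + 2 * ENNReal.ofReal (1 / (n * ε ^ 2)) + expTail J
      + 2 * (π Sᶜ / π (klBall ν p n θ₀ ε)
          / ENNReal.ofReal (Real.exp (-(2 * (1 + C) * (n * ε ^ 2)))) + expTail J) := by
  have hpm (θ : Θ) : Measurable (p θ) := hp.of_uncurry_left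
  have := isProbabilityMeasure_sampleLaw hp_one n θ₀
  have hR := measurable_likelihood_ratio hp n θ₀
  have hj61 (k : ℕ) : (61 : ℝ) ≤ ((J + k : ℕ) : ℝ) := by exact_mod_cast (by omega : 61 ≤ J + k)
  have hJk (k : ℕ) : (J : ℝ) ≤ ((J + k : ℕ) : ℝ) := by exact_mod_cast Nat.le_add_right J k
  choose Φ hΦm hΦ₀ hΦ₁ using fun k : ℕ => exists_shell_test hpm hp_one hn θ₀ S hε h_entropy
    (j := J + k) (by omega)
  have hΦ : MeasurableSet (⋃ k, Φ k) := MeasurableSet.iUnion hΦm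
  set μ := sampleLaw ν p n θ₀ with hμ
  set b := π (klBall ν p n θ₀ ε) with hb
  set R : Θ → (Fin n → 𝓧) → ℝ≥0∞ := fun θ x => likelihood p θ x / likelihood p θ₀ x with hRdef
  have htype1 : μ (⋃ k, Φ k) ≤ expTail J := by
    refine (measure_iUnion_le _).trans (ENNReal.tsum_le_tsum fun k => (hΦ₀ k).trans ?_)
    rw [← ENNReal.ofReal_mul (Real.exp_nonneg _), ← Real.exp_add]
    apply ENNReal.ofReal_le_ofReal
    apply Real.exp_le_exp.2
    have hk := hj61 k
    generalize ((J + k : ℕ) : ℝ) = j at *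
    -- The `1` is the entropy cost; `n ε² ≥ 1` then gives a type I error of at most `e^{-j}`.
    have h1 : j ≤ j ^ 2 / 6 - 1 := by nlinarith
    nlinarith [mul_le_mul hnε h1 (by linarith) (by linarith)]
  have hmass (T : Set Θ) (K : ℝ≥0∞) (hK : ∀ θ ∈ T, ∫⁻ x in (⋃ k, Φ k)ᶜ, R θ x ∂μ ≤ K) :
      ∫⁻ x in (⋃ k, Φ k)ᶜ, ∫⁻ θ in T, R θ x ∂π ∂μ ≤ K * π T := by
    rw [lintegral_lintegral_swap (f := fun x θ => R θ x) (hR.comp measurable_swap).aemeasurable]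
    refine (setLIntegral_mono measurable_const hK).trans_eq ?_
    rw [setLIntegral_const]
  have hnum : ∫⁻ x in (⋃ k, Φ k)ᶜ, ∫⁻ θ in {θ | M * ε < hellinger ν p n θ θ₀}, R θ x ∂π ∂μ
      ≤ π Sᶜ + ∑' k, ENNReal.ofReal (Real.exp (-(n * ((J + k : ℕ) * ε) ^ 2 / 3)))
          * π (shell ν p n θ₀ S ε (J + k)) := by
    calc _ ≤ ∫⁻ x in (⋃ k, Φ k)ᶜ, (∫⁻ θ in Sᶜ, R θ x ∂π
          + ∑' k, ∫⁻ θ in shell ν p n θ₀ S ε (J + k), R θ x ∂π) ∂μ := by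
          refine lintegral_mono fun x => ?_
          refine (lintegral_mono_set (subset_iUnion_shell ν p n θ₀ S hε (by omega) hJM)).trans ?_
          refine (lintegral_union_le _ _ _).trans ?_
          gcongr
          exact lintegral_iUnion_le _ _
      _ = ∫⁻ x in (⋃ k, Φ k)ᶜ, ∫⁻ θ in Sᶜ, R θ x ∂π ∂μ
          + ∑' k, ∫⁻ x in (⋃ k, Φ k)ᶜ, ∫⁻ θ in shell ν p n θ₀ S ε (J + k), R θ x ∂π ∂μ := by
          rw [lintegral_add_left hR.lintegral_prod_left', lintegral_tsum]
          exact fun k => hR.lintegral_prod_left'.aemeasurable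
      _ ≤ 1 * π Sᶜ + ∑' k, ENNReal.ofReal (Real.exp (-(n * ((J + k : ℕ) * ε) ^ 2 / 3)))
          * π (shell ν p n θ₀ S ε (J + k)) := by
          refine add_le_add (hmass _ _ fun θ _ => ?_) (ENNReal.tsum_le_tsum fun k =>
            hmass _ _ fun θ hθ => ?_)
          · exact (setLIntegral_le_lintegral _ _).trans
              (lintegral_likelihood_ratio_le_one hpm hp_one n θ₀ θ)
          · exact (lintegral_mono_set (compl_subset_compl.2 (subset_iUnion Φ k))).trans
              (hΦ₁ k θ hθ)
      _ = _ := by rw [one_mul]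
  refine (lintegral_pseudoPosterior_le hp hp_one π hn θ₀ hε ρ u (n * (C * ε ^ 2)) _ hΦ).trans ?_
  refine add_le_add (by gcongr) ?_
  set G := ENNReal.ofReal (Real.exp (-(2 * (1 + C) * (n * ε ^ 2)))) with hG
  -- The residual factor and the evidence factor merge into `1 / G`; the `2` comes from halving the
  -- prior mass.
  have hden (a : ℝ≥0∞) : ENNReal.ofReal (Real.exp (2 * (n * (C * ε ^ 2))))
      * (a / (b / 2 * ENNReal.ofReal (Real.exp (-(2 * (n * ε ^ 2)))))) = 2 * (a / b / G) := by
    have h2 : ENNReal.ofReal (Real.exp (-(2 * (n * ε ^ 2)))) ≠ 0 := by simp [Real.exp_pos]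
    have h3 : G⁻¹ = ENNReal.ofReal (Real.exp (2 * (n * (C * ε ^ 2))))
        * (ENNReal.ofReal (Real.exp (-(2 * (n * ε ^ 2)))))⁻¹ := by
      rw [hG, ← ENNReal.ofReal_inv_of_pos (Real.exp_pos _),
        ← ENNReal.ofReal_inv_of_pos (Real.exp_pos _), ← ENNReal.ofReal_mul (Real.exp_nonneg _),
        ← Real.exp_neg, ← Real.exp_neg, ← Real.exp_add]
      congr 2
      ring
    simp only [div_eq_mul_inv]
    rw [h3, ENNReal.mul_inv (Or.inr ENNReal.ofReal_ne_top) (Or.inr h2),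
      ENNReal.mul_inv (Or.inr (by simp)) (Or.inr (by simp)), inv_inv]
    ring
  rw [hden]
  gcongr 2 * ?_
  calc _ ≤ (π Sᶜ + ∑' k, ENNReal.ofReal (Real.exp (-(n * ((J + k : ℕ) * ε) ^ 2 / 3)))
          * π (shell ν p n θ₀ S ε (J + k))) / b / G := by gcongr
    _ = π Sᶜ / b / G + ∑' k, ENNReal.ofReal (Real.exp (-(n * ((J + k : ℕ) * ε) ^ 2 / 3)))
          * (π (shell ν p n θ₀ S ε (J + k)) / b) / G := by
        simp only [div_eq_mul_inv, add_mul, ← ENNReal.tsum_mul_right, mul_assoc]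
    _ ≤ _ := by
        refine add_le_add le_rfl (ENNReal.tsum_le_tsum fun k => ?_)
        refine ENNReal.div_le_of_le_mul ?_
        refine (mul_le_mul_right (h_shell (J + k) (by omega)) _).trans ?_
        rw [hG, ← ENNReal.ofReal_mul (Real.exp_nonneg _), ← ENNReal.ofReal_mul (Real.exp_nonneg _),
          ← Real.exp_add, ← Real.exp_add]
        apply ENNReal.ofReal_le_ofReal
        apply Real.exp_le_exp.2
        have hk := hj61 k
        have hk' := hJk k
        generalize ((J + k : ℕ) : ℝ) = j at *
        -- `1/12 = 1/3 - 1/4`. As `C ≤ 2J ≤ 2j`, it suffices that `j²/12 ≥ 5j + 2`, true from `j =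
        -- 61` on.
        have h1 : j ≤ j ^ 2 / 12 - 2 * (1 + C) := by nlinarith
        nlinarith [mul_le_mul hnε h1 (by linarith) (by linarith)]

end Bound

end MHC

end

/-! ### Passage to the limit -/

theorem theorem3
    {Θ 𝓧 𝓩 : Type*} [MeasurableSpace Θ] [MeasurableSpace 𝓧] [MeasurableSpace 𝓩]
    -- the model: densities `p_θ` with respect to `ν`, and the true parameter
    (ν : Measure 𝓧) [SigmaFinite ν]
    (p : Θ → 𝓧 → ℝ≥0) (hp : Measurable (Function.uncurry p))
    (hp_one : ∀ θ, ∫⁻ x, (p θ x : ℝ≥0∞) ∂ν = 1) (θ₀ : Θ)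
    -- the priors
    (prior : ℕ → Measure Θ) [∀ n, IsProbabilityMeasure (prior n)]
    -- the generator `T_θ` and the law of the `m n` latent variables, which are independent of
    -- the observations (i.i.d. draws are one case, fixed latent values another)
    (m : ℕ → ℕ) (latent : ∀ n, Measure (Fin (m n) → 𝓩)) [∀ n, IsProbabilityMeasure (latent n)]
    (T : Θ → 𝓩 → 𝓧) (hT : Measurable (Function.uncurry T))
    -- the classifier trained on the observed data and the fake data generated under `θ`
    (Dhat : ∀ n, Θ → (Fin n → 𝓧) → (Fin (m n) → 𝓧) → 𝓧 → ℝ)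
    (hD : ∀ n, Measurable fun q : Θ × (Fin n → 𝓧) × (Fin (m n) → 𝓧) × 𝓧 =>
      Dhat n q.1 q.2.1 q.2.2.1 q.2.2.2)
    (hD01 : ∀ n θ x x' y, Dhat n θ x x' y ∈ Ioo (0 : ℝ) 1)
    -- the rate
    (ε : ℕ → ℝ) (hε_pos : ∀ n, 0 < ε n) (hε : Tendsto ε atTop (𝓝 0))
    (hnε : Tendsto (fun n : ℕ => (n : ℝ) * ε n ^ 2) atTop atTop)
    -- the sieve, the local entropy condition and the prior mass condition on shells
    (S : ℕ → Set Θ) (hS : ∀ n, MeasurableSet (S n))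
    (h_entropy : ∀ᶠ n : ℕ in atTop,
      (⨆ r ∈ Ioi (ε n), ENNReal.log
          (MHC.coveringNumber (MHC.hellinger ν p n) (r / 36)
            {θ ∈ S n | MHC.hellinger ν p n θ θ₀ < r} : ℝ≥0∞) : EReal)
        ≤ (((n : ℝ) * ε n ^ 2 : ℝ) : EReal))
    (h_shell : ∃ j₀ : ℕ, ∀ᶠ n : ℕ in atTop, ∀ j : ℕ, j₀ ≤ j →
      prior n {θ ∈ S n | (j : ℝ) * ε n < MHC.hellinger ν p n θ θ₀ ∧
            MHC.hellinger ν p n θ θ₀ ≤ 2 * (j : ℝ) * ε n}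
          / prior n (MHC.klBall ν p n θ₀ (ε n))
        ≤ ENNReal.ofReal (Real.exp ((n : ℝ) * ε n ^ 2 * (j : ℝ) ^ 2 / 4)))
    -- the uniform bound on the residual, with probability tending to one
    (C : ℕ → ℝ)
    (h_residual : Tendsto (fun n : ℕ =>
      ((MHC.sampleLaw ν p n θ₀).prod (latent n))
        {ω | ((C n * ε n ^ 2 : ℝ) : EReal)
          < ((⨆ θ, (MHC.residual p θ₀ θ (Dhat n θ ω.1 fun i => T θ (ω.2 i)) ω.1).abs
              / (n : ℝ≥0∞) : ℝ≥0∞) : EReal)}) atTop (𝓝 0))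
    -- the prior mass outside the sieve
    (h_sieve : Tendsto (fun n : ℕ =>
      prior n (S n)ᶜ / prior n (MHC.klBall ν p n θ₀ (ε n))
        / ENNReal.ofReal (Real.exp (-(2 * (1 + C n) * ((n : ℝ) * ε n ^ 2))))) atTop (𝓝 0))
    (M : ℕ → ℝ) (hM : Tendsto M atTop atTop) (hCM : C =o[atTop] M) :
    Tendsto (fun n : ℕ =>
      ∫⁻ ω, MHC.pseudoPosterior p θ₀ (prior n) ω.1
          (fun θ => MHC.residual p θ₀ θ (Dhat n θ ω.1 fun i => T θ (ω.2 i)) ω.1)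
          {θ | M n * ε n < MHC.hellinger ν p n θ θ₀}
        ∂((MHC.sampleLaw ν p n θ₀).prod (latent n))) atTop (𝓝 0) := by
  obtain ⟨j₀, h_shell⟩ := h_shell
  set J : ℕ → ℕ := fun n => ⌊M n⌋₊ with hJ
  have hJtop : Tendsto J atTop atTop := tendsto_nat_floor_atTop.comp hM
  have htail : Tendsto (fun n => MHC.expTail (J n)) atTop (𝓝 0) := MHC.tendsto_expTail.comp hJtop
  have hevid : Tendsto (fun n : ℕ => 2 * ENNReal.ofReal (1 / (n * ε n ^ 2))) atTop (𝓝 0) := by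
    have h1 : Tendsto (fun n : ℕ => 1 / (n * ε n ^ 2)) atTop (𝓝 0) := by
      simp only [one_div]
      exact hnε.inv_tendsto_atTop
    have h2 := ENNReal.Tendsto.const_mul (a := 2) (ENNReal.tendsto_ofReal h1)
      (Or.inr (by simp))
    simpa using h2
  have hlim := ((h_residual.add hevid).add htail).add
    (ENNReal.Tendsto.const_mul (a := 2) (h_sieve.add htail) (Or.inr (by simp)))
  simp only [add_zero, mul_zero] at hlim
  refine tendsto_of_tendsto_of_tendsto_of_le_of_le' tendsto_const_nhds hlim
    (Eventually.of_forall fun _ => zero_le) ?_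
  filter_upwards [h_entropy, h_shell, hnε.eventually_ge_atTop 1, hJtop.eventually_ge_atTop 61,
    hJtop.eventually_ge_atTop j₀, hM.eventually_ge_atTop 0, hCM.bound one_pos,
    eventually_ne_atTop 0] with n hent hsh hn1 hJ61 hJj₀ hM0 hCn hn
  have hJM : (J n : ℝ) ≤ M n := Nat.floor_le hM0
  -- The little-o with constant one gives `C ≤ M < J + 1 ≤ 2J`.
  have hC : C n ≤ 2 * J n := by
    have h1 : C n ≤ M n := by
      rw [one_mul, Real.norm_of_nonneg hM0] at hCn
      exact (le_abs_self _).trans hCn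
    have h2 : M n < J n + 1 := Nat.lt_floor_add_one _
    have h3 : (61 : ℝ) ≤ J n := by exact_mod_cast hJ61
    linarith
  refine (MHC.lintegral_pseudoPosterior_compl_ball_le hp hp_one (prior n) hn θ₀ (hε_pos n)
    (latent n) (fun θ ω => MHC.residual p θ₀ θ (Dhat n θ ω.1 fun i => T θ (ω.2 i)) ω.1) (S n)
    hn1 hJ61 hJM hC hent (fun j hj => hsh j (hJj₀.trans hj))).trans ?_
  gcongr with ω
  intro hω
  by_contra hle
  refine hω fun θ => MHC.abs_le_of_abs_div_le hn ?_
  refine le_trans ?_ (not_lt.1 hle)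
  exact EReal.coe_ennreal_le_coe_ennreal_iff.2 (le_iSup (fun θ =>
    (MHC.residual p θ₀ θ (Dhat n θ ω.1 fun i => T θ (ω.2 i)) ω.1).abs / (n : ℝ≥0∞)) θ)
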